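/- **Conventions.** All maps are smooth. Let $\Sigma$ be a simply connected Riemann surface. Let $\mathbb S^3$ be the unit sphere of the quaternions, with its group structure and round metric, and let $E_1=i,\ E_2=j,\ E_3=k$ be the basis of its Lie algebra (so $[E_1,E_2]=2E_3$ and cyclically), declared positively oriented and extended to $\mathbb S^3$ by left translation; $\mathbb R^3$ carries its standard metric, orientation and additive group structure. Let $M$ be $\mathbb S^3$ or $\mathbb R^3$. The extrinsic curvature of an immersed surface is the determinant of its shape operator. For an immersion $\varphi:\Sigma\to M$ with positive extrinsic curvature, $N$ denotes the unit normal field for which the second fundamental form $II=\langle -\nabla N,d\varphi\rangle$ is positive definite, and the Gauss map $g:\Sigma\to\mathbb C\cup\{\infty\}$ is $g=\dfrac{N_1+iN_2}{1-N_3}$, where $N=\sum_j N_jE_j(\varphi)$ and $E_j(\varphi)$ is the left invariant frame (the standard one for $M=\mathbb R^3$), with $g=\infty$ where $N_3=1$. We say that the conformal structure of $\Sigma$ is the one induced by $II$ if every local complex coordinate $z=x+iy$ of $\Sigma$ satisfies $II=2\rho\,|dz|^2$ with $\rho>0$ and $(\varphi_x,\varphi_y,N)$ is positively oriented. For a nowhere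 zero complex function $F$, $(\log F)_z$ means $F_z/F$ (local branches of the logarithm). **Proposition.** (1) Let $\psi:\Sigma\to\mathbb S^3$ be an immersion with positive extrinsic curvature $K$ and Gauss map $g$, such that the conformal structure of $\Sigma$ is the one induced by the second fundamental form of $\psi$. Assume that in local complex coordinates $z$ $$\left(\frac{K_z}{2\sqrt K\,(1+K)}\right)_{\bar z}=0 .$$ Then there is an immersion $\psi^*:\Sigma\to\mathbb R^3$ with the same Gauss map $g$, whose second fundamental form induces the same conformal structure (that of $\Sigma$), and whose extrinsic curvature $K^*$ is positive and satisfies, in local complex coordinates, $$(\log K^*)_z=\left(\log\frac{(i+\sqrt K)^4}{K}\right)_z .\qquad (*)$$ (2) Conversely, let $\psi^*:\Sigma\to\mathbb R^3$ be an immersion with Gauss map $g$ and positive extrinsic curvature $K^*$, such that the conformal structure of $\Sigma$ is the one induced by the second fundamental form of $\psi^*$. If $K:\Sigma\to\mathbb R$ is a positive smooth function satisfying $(*)$, then there is an immersion $\psi:\Sigma\to\mathbb S^3$ with extrinsic curvature $K$ and the same Gauss map $g$, whose second fundamental form induces the same conformal structure (that of $\Sigma$). -/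

import Mathlib

open scoped Manifold ContDiff Quaternion ComplexConjugate

noncomputable section

namespace GaussMapSurfaces

/-- Euclidean three-space, which is also the Lie algebra of each of the two ambient groups,
written in the orthonormal basis `E₁, E₂, E₃`. -/
abbrev E3 : Type := EuclideanSpace ℝ (Fin 3)

/-- The canonical three-sphere, as the Lie group of unit quaternions (equivalently `SU(2)`). -/
abbrev S3 : Type := Metric.sphere (0 : ℍ[ℝ]) 1

/-! ### Complex derivatives in a local coordinate -/

/-- The Wirtinger derivative `f_z = (f_x - i f_y) / 2`. -/
def dz (f : ℂ → ℂ) (ζ : ℂ) : ℂ :=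
  (fderiv ℝ f ζ 1 - Complex.I * fderiv ℝ f ζ Complex.I) / 2

/-- The Wirtinger derivative `f_{z̄} = (f_x + i f_y) / 2`. -/
def dzbar (f : ℂ → ℂ) (ζ : ℂ) : ℂ :=
  (fderiv ℝ f ζ 1 + Complex.I * fderiv ℝ f ζ Complex.I) / 2

/-! ### Pointwise surface theory in a coordinate `z`

Here `T : ℂ → V` is the differential of the immersion in the coordinate `z = x + i y` (so that
`T 1` and `T i` are the `x`- and `y`-derivative), and `D : ℂ → V` sends `v` to the covariant
derivative `∇_v N` of the unit normal field. -/

section Pointwise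

variable {V : Type*} [NormedAddCommGroup V] [InnerProductSpace ℝ V]

/-- The second fundamental form `II (v, w) = ⟨-∇_v N, dψ w⟩`. -/
def secondForm (T D : ℂ →L[ℝ] V) (v w : ℂ) : ℝ := inner ℝ (-(D v)) (T w)

/-- `II = 2 ρ |dz|²` for some `ρ > 0`: the second fundamental form is positive definite and `z`
is a conformal parameter for it. -/
def ConformalSecondForm (T D : ℂ →L[ℝ] V) : Prop :=
  ∃ ρ : ℝ, 0 < ρ ∧ ∀ v w : ℂ, secondForm T D v w = 2 * ρ * (v * conj w).re

/-- `k` is the determinant of the shape operator `S`, where `dψ (S v) = -∇_v N`. -/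
def ShapeDet (T D : ℂ →L[ℝ] V) (k : ℝ) : Prop :=
  ∃ S : ℂ →ₗ[ℝ] ℂ, (∀ v, T (S v) = -(D v)) ∧ LinearMap.det S = k

end Pointwise

/-- The oriented volume of three vectors of `ℝ³`. -/
def vol3 (a b c : E3) : ℝ := Matrix.det (Matrix.of ![a.ofLp, b.ofLp, c.ofLp])

/-- Left translation `v ↦ q⁻¹ v` of a tangent vector `v` of the sphere at `q` to the Lie algebra,
which consists of the imaginary quaternions, in the basis `E₁ = i`, `E₂ = j`, `E₃ = k`.  One has
`[E₁, E₂] = 2 E₃` and cyclically, so this is the positively oriented orthonormal basis for which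
all three constants `μ₁, μ₂, μ₃` are `1`. -/
def leftTranslate (q v : ℍ[ℝ]) : E3 :=
  !₂[(q⁻¹ * v).imI, (q⁻¹ * v).imJ, (q⁻¹ * v).imK]

/-- Stereographic projection from the north pole, `(N₁ + i N₂) / (1 - N₃)`, with values in
`ℂ ∪ {∞}`. -/
def stereo (n : E3) : OnePoint ℂ :=
  if n 2 = 1 then OnePoint.infty
  else (((n 0 : ℂ) + Complex.I * (n 1 : ℂ)) / (1 - (n 2 : ℂ)) : ℂ)

/-- Covariant derivative in the sphere, along a map with value `q` and in the direction `v`, of a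
field with ambient derivative `A`: the component of `A v` tangent to the sphere at `q`. -/
def sphereCov (q : ℍ[ℝ]) (A : ℂ →L[ℝ] ℍ[ℝ]) : ℂ →L[ℝ] ℍ[ℝ] :=
  A - ((innerSL ℝ q).comp A).smulRight q

section Surfaces

variable {X : Type*} [TopologicalSpace X] [ChartedSpace ℂ X]

/-- The differential at `ζ` of a map `f` on the surface, written in the local complex coordinate
`z = e`. -/
def coordDeriv {V : Type*} [NormedAddCommGroup V] [NormedSpace ℝ V]
    (e : OpenPartialHomeomorph X ℂ) (f : X → V) (ζ : ℂ) : ℂ →L[ℝ] V :=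
  fderiv ℝ (f ∘ e.symm) ζ

/-- `ψ : X → ℝ³` is a smooth immersion of the Riemann surface `X` with unit normal field `N` and
extrinsic curvature `K`, such that the second fundamental form with respect to `N` is positive
definite and induces the conformal structure of `X`, the surface being oriented by `N`: if
`z = x + i y` is a complex coordinate of `X` then `(ψ_x, ψ_y, N)` is positively oriented. -/
structure IsSurfaceR3 (ψ N : X → E3) (K : X → ℝ) : Prop where
  smooth : ContMDiff 𝓘(ℝ, ℂ) 𝓘(ℝ, E3) ∞ ψ
  smooth_normal : ContMDiff 𝓘(ℝ, ℂ) 𝓘(ℝ, E3) ∞ N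
  unit : ∀ p, ‖N p‖ = 1
  immersion : ∀ e ∈ atlas ℂ X, ∀ ζ ∈ e.target, Function.Injective (coordDeriv e ψ ζ)
  normal : ∀ e ∈ atlas ℂ X, ∀ ζ ∈ e.target, ∀ v,
    inner ℝ (N (e.symm ζ)) (coordDeriv e ψ ζ v) = 0
  conformal : ∀ e ∈ atlas ℂ X, ∀ ζ ∈ e.target,
    ConformalSecondForm (coordDeriv e ψ ζ) (coordDeriv e N ζ)
  oriented : ∀ e ∈ atlas ℂ X, ∀ ζ ∈ e.target,
    0 < vol3 (coordDeriv e ψ ζ 1) (coordDeriv e ψ ζ Complex.I) (N (e.symm ζ))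
  curvature : ∀ e ∈ atlas ℂ X, ∀ ζ ∈ e.target,
    ShapeDet (coordDeriv e ψ ζ) (coordDeriv e N ζ) (K (e.symm ζ))

/-- The Gauss map of a surface in `ℝ³` with unit normal `N` (left translations of the group `ℝ³`
being the Euclidean translations). -/
def gaussMapR3 (N : X → E3) (p : X) : OnePoint ℂ := stereo (N p)

/-- The inclusion of the sphere in the quaternions, along `ψ`. -/
def amb (ψ : X → S3) (p : X) : ℍ[ℝ] := (ψ p : ℍ[ℝ])

/-- The analogue of `IsSurfaceR3` for the three-sphere.  Vectors tangent to the sphere are regarded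
as quaternions, and a map into the sphere is smooth if and only if it is smooth as a map into the
quaternions.  The orientation of the sphere is the left invariant one for which
`E₁, E₂, E₃` is positive. -/
structure IsSurfaceS3 (ψ : X → S3) (N : X → ℍ[ℝ]) (K : X → ℝ) : Prop where
  smooth : ContMDiff 𝓘(ℝ, ℂ) 𝓘(ℝ, ℍ[ℝ]) ∞ (amb ψ)
  smooth_normal : ContMDiff 𝓘(ℝ, ℂ) 𝓘(ℝ, ℍ[ℝ]) ∞ N
  unit : ∀ p, ‖N p‖ = 1
  tangent : ∀ p, inner ℝ (N p) (amb ψ p) = 0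
  immersion : ∀ e ∈ atlas ℂ X, ∀ ζ ∈ e.target, Function.Injective (coordDeriv e (amb ψ) ζ)
  normal : ∀ e ∈ atlas ℂ X, ∀ ζ ∈ e.target, ∀ v,
    inner ℝ (N (e.symm ζ)) (coordDeriv e (amb ψ) ζ v) = 0
  conformal : ∀ e ∈ atlas ℂ X, ∀ ζ ∈ e.target,
    ConformalSecondForm (coordDeriv e (amb ψ) ζ)
      (sphereCov (amb ψ (e.symm ζ)) (coordDeriv e N ζ))
  oriented : ∀ e ∈ atlas ℂ X, ∀ ζ ∈ e.target,
    0 < vol3 (leftTranslate (amb ψ (e.symm ζ)) (coordDeriv e (amb ψ) ζ 1))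
      (leftTranslate (amb ψ (e.symm ζ)) (coordDeriv e (amb ψ) ζ Complex.I))
      (leftTranslate (amb ψ (e.symm ζ)) (N (e.symm ζ)))
  curvature : ∀ e ∈ atlas ℂ X, ∀ ζ ∈ e.target,
    ShapeDet (coordDeriv e (amb ψ) ζ)
      (sphereCov (amb ψ (e.symm ζ)) (coordDeriv e N ζ)) (K (e.symm ζ))

/-- The Gauss map of a surface in the three-sphere: the unit normal is left translated to the
identity and then projected stereographically. -/
def gaussMapS3 (ψ : X → S3) (N : X → ℍ[ℝ]) (p : X) : OnePoint ℂ :=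
  stereo (leftTranslate (amb ψ p) (N p))

/-- The equation `(K_z / (2 √K (1 + K)))_{z̄} = 0`, in every local complex coordinate `z`. -/
def CurvatureCondition (K : X → ℝ) : Prop :=
  ∀ e ∈ atlas ℂ X, ∀ ζ ∈ e.target,
    dzbar (fun w => dz (fun u => (K (e.symm u) : ℂ)) w /
      (2 * (√(K (e.symm w)) : ℂ) * (1 + (K (e.symm w) : ℂ)))) ζ = 0

/-- The function `(i + √K)⁴ / K` on the surface. -/
def curvatureFactor (K : X → ℝ) (p : X) : ℂ :=
  (Complex.I + (√(K p) : ℂ)) ^ 4 / (K p : ℂ)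

/-- The equation `(log Kstar)_z = (log ((i + √K)⁴ / K))_z`, in every local complex coordinate `z`.
For a nowhere vanishing complex function `F`, `(log F)_z` is computed with local branches of
the logarithm, that is, it equals `F_z / F`. (The principal branch would be discontinuous
where `K = 1`.) -/
def CurvatureRelation (K Kstar : X → ℝ) : Prop :=
  ∀ e ∈ atlas ℂ X, ∀ ζ ∈ e.target,
    dz (fun w => (Real.log (Kstar (e.symm w)) : ℂ)) ζ =
      dz (fun w => curvatureFactor K (e.symm w)) ζ / curvatureFactor K (e.symm ζ)

end Surfaces

end GaussMapSurfaces

end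

/-! Everything is expressed through the left translated unit normal `n`, a map into the unit
imaginary quaternions, so that `n * n = -1` and `n` anticommutes with `dn`. The Gauss map is the
stereographic image of `n`; keeping `n` keeps the Gauss map.

In a coordinate conformal for the second fundamental form, the Weingarten equation is algebraic. In
Euclidean space it reads `dn v = √K* n dψ*(i v)`. In the sphere, with `τ = ψ⁻¹ dψ`, the product rule
for the normal `ψ n` turns it into `dn v = n τ(v) + √K n τ(i v)`. Each equation can be solved for
the differential of the surface, and both solutions have the form `a n dn + b n (dn ∘ i)`:
`euclideanForm` has `a = 0`, `b = 1/√K*`, and `sphereForm` has `a = -1/(1+K)`, `b = √K/(1+K)`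
(lemmas `eq_euclideanForm`, `eq_sphereForm`). Conversely, integrating either form recovers the
Weingarten equation, hence the conformal structure and the curvature (`conformal_of_weingarten`).

A surface in space with the given `n` therefore exists when its form is closed, and a surface in the
sphere when its form is flat, `dτ + τ ∧ τ = 0`. The central point is `flat_sphereForm_iff`. For the
spherical coefficients `a² + b² = -a`, so the commutator of `τ` cancels the commutator terms of
`dτ`; under the relation between `K` and `K*`, what remains is a nonzero multiple of the curl of the
Euclidean form. The two integrability conditions are thus equivalent, which gives the converse
statement once flat forms can be integrated.

For the direct statement a suitable `K*` must also be found. With `k = √K`, the relation splits into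
a term that integrates explicitly to `log ((1+K)²/K)` and the term `-4i k_z/(1+k²)`, which has to be
`λ_z` for a real `λ`. As `K_z/(2√K(1+K))` is the derivative of `arctan k`, the curvature condition
says that `arctan k` is harmonic, and `λ` is four times a harmonic conjugate
(`closed_curvatureForm`, `realRelation_of_primitive`).

Global integration is `exists_global_parallel`: local parallel frames of a flat form differ by
locally constant left factors, so their multiples are the sections of a covering, which has a global
section over a simply connected surface. -/

noncomputable section

namespace GaussMapSurfaces

open Metric Set Filter Topology

/-! ### Local parallel frames of flat connection forms -/

section Local

variable {E 𝔸 : Type*} [NormedAddCommGroup E] [NormedSpace ℝ E]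
  [NormedDivisionRing 𝔸] [NormedAlgebra ℝ 𝔸]

/-- A solution of the linear equation `u' = u B` on the unit interval, for small `B`. -/
theorem exists_linear_ode_solution [CompleteSpace 𝔸] {B : ℝ → 𝔸} (hB : ContinuousOn B (Icc 0 1))
    (hb : ∀ t ∈ Icc (0 : ℝ) 1, ‖B t‖ ≤ 1 / 2) :
    ∃ u : ℝ → 𝔸, u 0 = 1 ∧
      ∀ t ∈ Icc (0 : ℝ) 1, HasDerivWithinAt u (u t * B t) (Icc 0 1) t := by
  -- On the unit ball around `1` one has `‖x‖ ≤ 2`, so `‖x * B t‖ ≤ 1` and the solution cannot leave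
  -- the ball before time `1`; this is what the bound `1 / 2` is for.
  have h : IsPicardLindelof (fun t x => x * B t) (tmin := 0) (tmax := 1)
      ⟨0, by simp⟩ (1 : 𝔸) 1 0 1 1 := by
    refine ⟨fun t ht => ?_, fun x _ => continuousOn_const.mul hB, fun t ht x hx => ?_, by simp⟩
    · refine LipschitzOnWith.of_dist_le_mul fun x _ y _ => ?_
      rw [dist_eq_norm, dist_eq_norm, ← sub_mul, norm_mul]
      have := hb t ht
      have := norm_nonneg (x - y)
      simp only [NNReal.coe_one]
      nlinarith
    · have h1 : ‖x‖ ≤ 2 := by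
        have := norm_sub_norm_le x 1
        rw [mem_closedBall, dist_eq_norm] at hx
        simp only [norm_one, NNReal.coe_one] at *
        linarith
      have := hb t ht
      rw [norm_mul]
      simp only [NNReal.coe_one]
      nlinarith [norm_nonneg x, norm_nonneg (B t)]
  obtain ⟨u, hu, hd⟩ := h.exists_eq_forall_mem_Icc_hasDerivWithinAt₀
  exact ⟨u, hu, hd⟩

/-- Local bounds for a twice continuously differentiable map. -/
theorem exists_local_bounds {G : Type*} [NormedAddCommGroup G] [NormedSpace ℝ G]
    {f : E → G} {x : E} (hf : ContDiffAt ℝ 2 f x) :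
    ∃ R > 0, ∃ C > 0, ∀ p ∈ ball x R, DifferentiableAt ℝ f p ∧ ‖f p‖ ≤ C ∧
      ∀ q ∈ ball x R, ‖f q - f p‖ ≤ C * ‖q - p‖ ∧
        ‖f q - f p - fderiv ℝ f p (q - p)‖ ≤ C * ‖q - p‖ ^ 2 := by
  have h1 : ∀ᶠ p in 𝓝 x, DifferentiableAt ℝ f p := by
    filter_upwards [(hf.of_le one_le_two).eventually (by simp)] with p hp
    exact hp.differentiableAt (by simp)
  have h2 : ∀ᶠ p in 𝓝 x, ‖f p‖ < ‖f x‖ + 1 :=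
    hf.continuousAt.norm.eventually (gt_mem_nhds (by linarith))
  have hd : ContDiffAt ℝ 1 (fderiv ℝ f) x := hf.fderiv_right (by norm_num)
  have h3 : ∀ᶠ p in 𝓝 x, ‖fderiv ℝ f p‖ < ‖fderiv ℝ f x‖ + 1 :=
    hd.continuousAt.norm.eventually (gt_mem_nhds (by linarith))
  obtain ⟨K, t, ht, hK⟩ := hd.exists_lipschitzOnWith
  obtain ⟨R, hR, hball⟩ := Metric.eventually_nhds_iff_ball.1 ((h1.and h2).and (h3.and ht))
  refine ⟨R, hR, ‖f x‖ + 1 + (‖fderiv ℝ f x‖ + 1) + K, by positivity, fun p hp => ?_⟩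
  have hp' := hball p hp
  refine ⟨hp'.1.1, ?_, fun q hq => ⟨?_, ?_⟩⟩
  · have := hp'.1.2
    have := norm_nonneg (fderiv ℝ f x)
    have := K.2
    simp only [NNReal.val_eq_coe] at this
    linarith
  · have := (convex_ball x R).norm_image_sub_le_of_norm_fderiv_le (𝕜 := ℝ) (f := f)
      (C := ‖fderiv ℝ f x‖ + 1) (fun y hy => (hball y hy).1.1) (fun y hy => (hball y hy).2.1.le)
      hp hq
    refine this.trans (mul_le_mul_of_nonneg_right ?_ (norm_nonneg _))
    have := norm_nonneg (f x)
    have := K.2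
    simp only [NNReal.val_eq_coe] at this
    linarith
  -- Within distance `‖q - p‖` of `p` the derivative differs from the one at `p` by at most `K * ‖q
  -- - p‖`, so the mean value inequality on this convex set gives a quadratic remainder.
  · have hc : Convex ℝ (ball x R ∩ closedBall p ‖q - p‖) :=
      (convex_ball x R).inter (convex_closedBall _ _)
    have := hc.norm_image_sub_le_of_norm_hasFDerivWithin_le' (𝕜 := ℝ) (f := f)
      (f' := fderiv ℝ f) (φ := fderiv ℝ f p) (C := K * ‖q - p‖) (x := p) (y := q)
      (fun y hy => (hball y hy.1).1.1.hasFDerivAt.hasFDerivWithinAt) (fun y hy => ?_)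
      ⟨hp, by simp⟩ ⟨hq, by simp [dist_eq_norm]⟩
    · refine this.trans ?_
      rw [mul_assoc, ← sq]
      refine mul_le_mul_of_nonneg_right ?_ (by positivity)
      have := norm_nonneg (f x)
      have := norm_nonneg (fderiv ℝ f x)
      linarith
    · have h := hK.dist_le_mul y (hball y hy.1).2.2 p hp'.2.2
      rw [dist_eq_norm, dist_eq_norm] at h
      refine h.trans (mul_le_mul_of_nonneg_left ?_ K.2)
      simpa [dist_eq_norm] using hy.2

theorem defect_identity {A : Type*} [Ring A] (u₁ u₀ a b c d e : A) :
    u₁ * b - u₀ * a - (u₀ * a * c + u₀ * (d + c * a - a * c + e)) =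
      (u₁ - u₀ - u₀ * c) * b + u₀ * (b - a - (d + e)) + u₀ * c * (b - a) := by
  simp only [mul_add, mul_sub, sub_mul, mul_assoc]
  abel

/-- The failure of the radial solution to be parallel satisfies a linear equation with a
quadratically small inhomogeneity. -/
theorem hasDerivWithinAt_defect {𝔸 : Type*} [NormedRing 𝔸] [NormedAlgebra ℝ 𝔸]
    {θ : E → E →L[ℝ] 𝔸} {w h : E} {t : ℝ} {I : Set ℝ}
    (hd : DifferentiableAt ℝ θ (t • w))
    (hf : fderiv ℝ θ (t • w) w (t • h) + θ (t • w) w * θ (t • w) (t • h) =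
      fderiv ℝ θ (t • w) (t • h) w + θ (t • w) (t • h) * θ (t • w) w)
    {u₀ u₁ : ℝ → 𝔸} {b : 𝔸} (h0 : HasDerivWithinAt u₀ (u₀ t * θ (t • w) w) I t)
    (h1 : HasDerivWithinAt u₁ (u₁ t * b) I t) :
    HasDerivWithinAt (fun t => u₁ t - u₀ t - u₀ t * θ (t • w) (t • h))
      ((u₁ t - u₀ t - u₀ t * θ (t • w) (t • h)) * b +
        u₀ t * (b - θ (t • w) w - (fderiv ℝ θ (t • w) (t • h) w + θ (t • w) h)) +
        u₀ t * θ (t • w) (t • h) * (b - θ (t • w) w)) I t := by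
  have hl : HasDerivAt (fun t : ℝ => t • w) w t := by
    simpa using (hasDerivAt_id t).smul_const w
  have hl' : HasDerivAt (fun t : ℝ => t • h) h t := by
    simpa using (hasDerivAt_id t).smul_const h
  have h2 : HasDerivAt (fun t : ℝ => θ (t • w) (t • h))
      (fderiv ℝ θ (t • w) w (t • h) + θ (t • w) h) t :=
by
    have hc : HasDerivAt (fun t : ℝ => θ (t • w)) (fderiv ℝ θ (t • w) w) t :=
      hd.hasFDerivAt.comp_hasDerivAt t hl
    exact hc.clm_apply hl'
  have h3 := (h1.fun_sub h0).fun_sub (h0.fun_mul h2.hasDerivWithinAt)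
  refine h3.congr_deriv ?_
  -- Flatness trades the derivative of `θ` along the ray for the derivative across it, which is the
  -- one occurring in the first order expansion of `θ (t • (w + h)) (w + h)`.
  have e1 : fderiv ℝ θ (t • w) w (t • h) = fderiv ℝ θ (t • w) (t • h) w +
      θ (t • w) (t • h) * θ (t • w) w - θ (t • w) w * θ (t • w) (t • h) := by
    rw [← hf]; abel
  rw [e1]
  exact defect_identity ..

/-- A flat connection form has a local parallel frame. -/
theorem exists_local_parallel_zero [CompleteSpace 𝔸] {θ : E → E →L[ℝ] 𝔸}
    (hθ : ContDiffAt ℝ 2 θ 0)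
    (flat : ∀ᶠ p in 𝓝 (0 : E), ∀ u v, fderiv ℝ θ p u v + θ p u * θ p v =
      fderiv ℝ θ p v u + θ p v * θ p u) :
    ∃ F : E → 𝔸, F 0 = 1 ∧ ∀ᶠ p in 𝓝 (0 : E), HasFDerivAt F (F p • θ p) p := by
  obtain ⟨R₁, hR₁, C, hC, hb⟩ := exists_local_bounds hθ
  obtain ⟨R₂, hR₂, hflat⟩ := Metric.eventually_nhds_iff_ball.1 flat
  -- The condition `C * r ≤ 1 / 2` makes the radial equation solvable up to time `1`.
  obtain ⟨r, hr, hr1, hr2, hr3, hr4⟩ : ∃ r > 0, r ≤ R₁ ∧ r ≤ R₂ ∧ C * r ≤ 1 / 2 ∧ r ≤ 1 := by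
    refine ⟨min (min R₁ R₂) (min (1 / (2 * C)) 1), by positivity, ?_, ?_, ?_, ?_⟩
    · exact (min_le_left _ _).trans (min_le_left _ _)
    · exact (min_le_left _ _).trans (min_le_right _ _)
    · calc C * min (min R₁ R₂) (min (1 / (2 * C)) 1) ≤ C * (1 / (2 * C)) := by
            gcongr; exact (min_le_right _ _).trans (min_le_left _ _)
        _ = 1 / 2 := by field_simp
    · exact (min_le_right _ _).trans (min_le_right _ _)
  have hmem : ∀ w ∈ ball (0 : E) r, ∀ t ∈ Icc (0 : ℝ) 1, t • w ∈ ball (0 : E) r := by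
    intro w hw t ht
    rw [mem_ball_zero_iff] at *
    rw [norm_smul, Real.norm_of_nonneg ht.1]
    nlinarith [norm_nonneg w, ht.1, ht.2]
  have hsub1 : ball (0 : E) r ⊆ ball 0 R₁ := ball_subset_ball hr1
  have hBn : ∀ w ∈ ball (0 : E) r, ∀ t ∈ Icc (0 : ℝ) 1, ‖θ (t • w) w‖ ≤ 1 / 2 := by
    intro w hw t ht
    have h1 := (hb _ (hsub1 (hmem w hw t ht))).2.1
    have h2 := (θ (t • w)).le_opNorm w
    rw [mem_ball_zero_iff] at hw
    refine h2.trans (le_trans ?_ hr3)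
    gcongr
  have hsol : ∀ w : E, ∃ u : ℝ → 𝔸, w ∈ ball (0 : E) r → u 0 = 1 ∧
      ∀ t ∈ Icc (0 : ℝ) 1, HasDerivWithinAt u (u t * θ (t • w) w) (Icc 0 1) t := by
    intro w
    by_cases hw : w ∈ ball (0 : E) r
    · have hc : ContinuousOn (fun t : ℝ => θ (t • w) w) (Icc 0 1) := by
        intro t ht
        have h1 := (hb _ (hsub1 (hmem w hw t ht))).1.continuousAt
        have h2 : ContinuousAt (fun t : ℝ => θ (t • w)) t :=
          ContinuousAt.comp (f := fun t : ℝ => t • w) (g := θ) h1 (by fun_prop)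
        exact (h2.clm_apply continuousAt_const).continuousWithinAt
      obtain ⟨u, hu⟩ := exists_linear_ode_solution hc (hBn w hw)
      exact ⟨u, fun _ => hu⟩
    · exact ⟨0, fun h => absurd h hw⟩
  choose u hu using hsol
  refine ⟨fun w => u w 1, ?_, ?_⟩
  · have h0 : (0 : E) ∈ ball (0 : E) r := mem_ball_self hr
    have hd := (hu 0 h0).2
    have : u 0 1 = u 0 0 := by
      refine constant_of_derivWithin_zero (a := 0) (b := 1) (f := u 0)
        (fun t ht => (hd t ht).differentiableWithinAt) (fun t ht => ?_) 1 (by simp)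
      have := (hd t ⟨ht.1, ht.2.le⟩).derivWithin
        (uniqueDiffOn_Icc zero_lt_one t ⟨ht.1, ht.2.le⟩)
      simpa using this
    exact this.trans (hu 0 h0).1
  refine Metric.eventually_nhds_iff_ball.2 ⟨r, hr, fun w hw => ?_⟩
  obtain ⟨U, hU⟩ : ∃ U, ∀ t ∈ Icc (0 : ℝ) 1, ‖u w t‖ ≤ U :=
    isCompact_Icc.exists_bound_of_continuousOn
      fun t ht => ((hu w hw).2 t ht).continuousWithinAt
  have hU0 : 0 ≤ U := (norm_nonneg _).trans (hU 0 (by simp))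
  -- The candidate `F w = u w 1` is defined by transport along rays. Its differential is obtained
  -- from Grönwall's inequality applied to the defect, which vanishes at time `0` and has a forcing
  -- term of order `‖h‖ ^ 2`, so no differentiable dependence on parameters is needed.
  have key : ∀ h : E, w + h ∈ ball (0 : E) r →
      ‖u (w + h) 1 - u w 1 - u w 1 * θ w h‖ ≤
        (U * (2 * C) + U * C * (2 * C)) * (Real.exp 1 - 1) * ‖h‖ ^ 2 := by
    intro h hwh
    set D : ℝ → 𝔸 := fun t => u (w + h) t - u w t - u w t * θ (t • w) (t • h) with hD
    set B₁ : ℝ → 𝔸 := fun t => θ (t • (w + h)) (w + h) with hB₁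
    set B₀ : ℝ → 𝔸 := fun t => θ (t • w) w with hB₀
    set B' : ℝ → 𝔸 := fun t => fderiv ℝ θ (t • w) (t • h) w + θ (t • w) h with hB'
    set D' : ℝ → 𝔸 := fun t => D t * B₁ t + u w t * (B₁ t - B₀ t - B' t) +
      u w t * θ (t • w) (t • h) * (B₁ t - B₀ t) with hD'
    have hder : ∀ t ∈ Icc (0 : ℝ) 1, HasDerivWithinAt D (D' t) (Icc 0 1) t := by
      intro t ht
      have hf := hflat _ (ball_subset_ball hr2 (hmem w hw t ht)) w (t • h)
      have h3 := hasDerivWithinAt_defect (hb _ (hsub1 (hmem w hw t ht))).1 hf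
        ((hu _ hw).2 t ht) ((hu _ hwh).2 t ht)
      refine h3.congr_deriv ?_
      simp only [hD', hD, hB₁, hB₀, hB']
    have hbound : ∀ t ∈ Ico (0 : ℝ) 1, ‖D' t‖ ≤ 1 * ‖D t‖ +
        (U * (2 * C) + U * C * (2 * C)) * ‖h‖ ^ 2 := by
      intro t ht'
      have ht : t ∈ Icc (0 : ℝ) 1 := ⟨ht'.1, ht'.2.le⟩
      have hp := hb _ (hsub1 (hmem w hw t ht))
      have hq := hp.2.2 _ (hsub1 (hmem _ hwh t ht))
      have hsubt : t • (w + h) - t • w = t • h := by rw [smul_add]; abel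
      have hth : ‖t • h‖ ≤ ‖h‖ := by
        rw [norm_smul, Real.norm_of_nonneg ht.1]
        nlinarith [norm_nonneg h, ht.2]
      rw [hsubt] at hq
      have hw1 : ‖w‖ ≤ 1 := (mem_ball_zero_iff.1 hw).le.trans hr4
      have hwh1 : ‖w + h‖ ≤ 1 := (mem_ball_zero_iff.1 hwh).le.trans hr4
      have b1 : ‖B₁ t‖ ≤ 1 := (hBn _ hwh t ht).trans (by norm_num)
      have l1 : ‖θ (t • (w + h)) - θ (t • w)‖ ≤ C * ‖h‖ := hq.1.trans (by gcongr)
      have l2 : ‖θ (t • (w + h)) - θ (t • w) - fderiv ℝ θ (t • w) (t • h)‖ ≤ C * ‖h‖ ^ 2 :=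
        hq.2.trans (by gcongr)
      have b2 : ‖B₁ t - B₀ t‖ ≤ 2 * C * ‖h‖ := by
        have e : B₁ t - B₀ t = (θ (t • (w + h)) - θ (t • w)) (w + h) + θ (t • w) h := by
          simp only [hB₁, hB₀, sub_apply, map_add]; abel
        rw [e]
        calc _ ≤ ‖θ (t • (w + h)) - θ (t • w)‖ * ‖w + h‖ + ‖θ (t • w)‖ * ‖h‖ :=
              (norm_add_le _ _).trans (add_le_add (ContinuousLinearMap.le_opNorm _ _)
                (ContinuousLinearMap.le_opNorm _ _))
          _ ≤ C * ‖h‖ * 1 + C * ‖h‖ := by gcongr; exact hp.2.1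
          _ = _ := by ring
      have b3 : ‖B₁ t - B₀ t - B' t‖ ≤ 2 * C * ‖h‖ ^ 2 := by
        have e : B₁ t - B₀ t - B' t =
            (θ (t • (w + h)) - θ (t • w) - fderiv ℝ θ (t • w) (t • h)) w +
              (θ (t • (w + h)) - θ (t • w)) h := by
          simp only [hB₁, hB₀, hB', sub_apply, map_add]; abel
        rw [e]
        calc _ ≤ ‖θ (t • (w + h)) - θ (t • w) - fderiv ℝ θ (t • w) (t • h)‖ * ‖w‖ +
                ‖θ (t • (w + h)) - θ (t • w)‖ * ‖h‖ :=
              (norm_add_le _ _).trans (add_le_add (ContinuousLinearMap.le_opNorm _ _)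
                (ContinuousLinearMap.le_opNorm _ _))
          _ ≤ C * ‖h‖ ^ 2 * 1 + C * ‖h‖ * ‖h‖ := by gcongr
          _ = _ := by ring
      have b4 : ‖θ (t • w) (t • h)‖ ≤ C * ‖h‖ :=
        (ContinuousLinearMap.le_opNorm _ _).trans (by gcongr; exact hp.2.1)
      have bu := hU t ht
      calc ‖D' t‖ ≤ ‖D t‖ * ‖B₁ t‖ + ‖u w t‖ * ‖B₁ t - B₀ t - B' t‖ +
            ‖u w t‖ * ‖θ (t • w) (t • h)‖ * ‖B₁ t - B₀ t‖ := by
            refine (norm_add_le _ _).trans (add_le_add ((norm_add_le _ _).trans ?_) ?_)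
            · rw [norm_mul, norm_mul]
            · rw [norm_mul, norm_mul]
        _ ≤ ‖D t‖ * 1 + U * (2 * C * ‖h‖ ^ 2) + U * (C * ‖h‖) * (2 * C * ‖h‖) := by gcongr
        _ = _ := by ring
    have hgr := norm_le_gronwallBound_of_norm_deriv_right_le (f := D) (f' := D') (δ := 0)
      (fun t ht => (hder t ht).continuousWithinAt)
      (fun t ht => (hder t ⟨ht.1, ht.2.le⟩).mono_of_mem_nhdsWithin
        (mem_nhdsWithin.2 ⟨Iio 1, isOpen_Iio, ht.2, fun y hy => ⟨ht.1.trans hy.2, hy.1.le⟩⟩))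
      (by simp [hD, (hu _ hwh).1, (hu _ hw).1]) hbound 1 (by simp)
    have e : D 1 = u (w + h) 1 - u w 1 - u w 1 * θ w h := by simp [hD]
    rw [← e]
    refine hgr.trans (le_of_eq ?_)
    simp only [gronwallBound_of_K_ne_0 one_ne_zero, zero_mul, zero_add, div_one, sub_zero,
      mul_one]
    ring
  rw [hasFDerivAt_iff_isLittleO_nhds_zero]
  have hO : (fun h : E => u (w + h) 1 - u w 1 - (u w 1 • θ w) h) =O[𝓝 0]
      fun h => ‖h‖ ^ 2 := by
    refine Asymptotics.IsBigO.of_bound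
      ((U * (2 * C) + U * C * (2 * C)) * (Real.exp 1 - 1)) ?_
    have : ∀ᶠ h in 𝓝 (0 : E), w + h ∈ ball (0 : E) r := by
      have hc : ContinuousAt (fun h : E => w + h) 0 := by fun_prop
      exact hc.eventually (isOpen_ball.mem_nhds (by simpa using hw))
    filter_upwards [this] with h hh
    have := key h hh
    rw [Real.norm_of_nonneg (by positivity : (0 : ℝ) ≤ ‖h‖ ^ 2)]
    simpa using this
  exact hO.trans_isLittleO (Asymptotics.isLittleO_norm_pow_id one_lt_two)

theorem exists_local_parallel [CompleteSpace 𝔸] {θ : E → E →L[ℝ] 𝔸} {x : E}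
    (hθ : ContDiffAt ℝ 2 θ x)
    (flat : ∀ᶠ p in 𝓝 x, ∀ u v, fderiv ℝ θ p u v + θ p u * θ p v =
      fderiv ℝ θ p v u + θ p v * θ p u) :
    ∃ F : E → 𝔸, F x = 1 ∧ ∀ᶠ p in 𝓝 x, HasFDerivAt F (F p • θ p) p := by
  have ht : Tendsto (fun p : E => p + x) (𝓝 0) (𝓝 x) := by
    have : ContinuousAt (fun p : E => p + x) 0 := by fun_prop
    simpa [ContinuousAt] using this
  have ht' : Tendsto (fun p : E => p - x) (𝓝 x) (𝓝 0) := by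
    have : ContinuousAt (fun p : E => p - x) x := by fun_prop
    simpa [ContinuousAt] using this
  obtain ⟨F, hF, hd⟩ := exists_local_parallel_zero (θ := fun p => θ (p + x))
    (ContDiffAt.comp (g := θ) (f := fun p => p + x) 0 (by simpa using hθ) (by fun_prop))
    (by filter_upwards [ht.eventually flat] with p hp
        simpa only [fderiv_comp_add_right] using hp)
  refine ⟨fun p => F (p - x), by simpa using hF, ?_⟩
  filter_upwards [ht'.eventually hd] with p hp
  have := HasFDerivAt.comp p hp ((hasFDerivAt_id p).sub_const x)
  simpa [Function.comp_def] using this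

end Local

/-! ### Gluing local sections over a simply connected space -/

section Gluing

/-- A type with its discrete topology. -/
structure Discrete (α : Type*) where
  /-- The underlying element. -/
  val : α

instance (α : Type*) : TopologicalSpace (Discrete α) := ⊥

instance (α : Type*) : DiscreteTopology (Discrete α) := ⟨rfl⟩

variable {X G : Type*} [TopologicalSpace X] [GroupWithZero G]

/-- The bundle with discrete fibre whose sections over `U i` are the left multiples `c * s i`. -/
def multiplesCore (U : X → Set X) (hU : ∀ i, IsOpen (U i)) (hmem : ∀ i, i ∈ U i) (s : X → X → G)
    (hs : ∀ i, ∀ x ∈ U i, s i x ≠ 0)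
    (hloc : ∀ i j, ∀ x ∈ U i ∩ U j, ∀ᶠ y in 𝓝 x, s i y * (s j y)⁻¹ = s i x * (s j x)⁻¹) :
    FiberBundleCore X X (Discrete G) where
  baseSet := U
  isOpen_baseSet := hU
  indexAt := id
  mem_baseSet_at := hmem
  coordChange i j x v := ⟨v.val * (s i x * (s j x)⁻¹)⟩
  coordChange_self i x hx v := by
    rw [mul_inv_cancel₀ (hs i x hx), mul_one]
  continuousOn_coordChange i j := by
    rintro ⟨x, v⟩ ⟨hx, -⟩
    refine ContinuousAt.continuousWithinAt ?_
    refine ContinuousAt.congr (f := fun _ => Discrete.mk (v.val * (s i x * (s j x)⁻¹)))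
      continuousAt_const ?_
    have h1 : ∀ᶠ p : X × Discrete G in 𝓝 (x, v), p.2 = v :=
      ContinuousAt.eventually_mem (f := fun p : X × Discrete G => p.2) (s := {v})
        continuous_snd.continuousAt ((isOpen_discrete {v}).mem_nhds rfl)
    have h2 : ∀ᶠ p : X × Discrete G in 𝓝 (x, v),
        s i p.1 * (s j p.1)⁻¹ = s i x * (s j x)⁻¹ :=
      (continuous_fst (X := X) (Y := Discrete G)).continuousAt.eventually
        (p := fun y => s i y * (s j y)⁻¹ = s i x * (s j x)⁻¹) (hloc i j x hx)
    filter_upwards [h1, h2] with p hp1 hp2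
    rw [hp1, hp2]
  coordChange_comp i j k x hx v := by
    refine congrArg Discrete.mk ?_
    rw [mul_assoc, mul_assoc, inv_mul_cancel_left₀ (hs j x hx.1.2)]

/-- On a simply connected space, local nowhere zero sections which differ by locally constant left
factors can be glued after multiplication by constants. -/
theorem exists_glued_section [SimplyConnectedSpace X] [LocallyPathConnectedSpace X]
    (U : X → Set X) (hU : ∀ i, IsOpen (U i)) (hmem : ∀ i, i ∈ U i) (s : X → X → G)
    (hs : ∀ i, ∀ x ∈ U i, s i x ≠ 0)
    (hloc : ∀ i j, ∀ x ∈ U i ∩ U j, ∀ᶠ y in 𝓝 x, s i y * (s j y)⁻¹ = s i x * (s j x)⁻¹) :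
    ∃ f : X → G, (∃ p, f p = 1) ∧ (∀ p, f p ≠ 0) ∧ ∀ i, ∃ c, ∀ᶠ x in 𝓝 i, f x = c * s i x := by
  let Z := multiplesCore U hU hmem s hs hloc
  -- A point of the fibre over `x` is a coefficient `c` standing for the value `c * s i x`; the
  -- transition factors are locally constant, so with discrete fibre the bundle is a covering, and a
  -- lift of the identity map is a global section.
  have hcov : IsCoveringMap (Bundle.TotalSpace.proj : Z.TotalSpace → X) :=
    FiberBundle.isCoveringMap (F := Discrete G) (E := Z.Fiber)
  obtain ⟨p₀⟩ : Nonempty X := inferInstance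
  obtain ⟨σ, ⟨hσ0, hσ⟩, -⟩ := hcov.existsUnique_continuousMap_lifts (ContinuousMap.id X) p₀
    (⟨p₀, Discrete.mk (s p₀ p₀)⁻¹⟩ : Z.TotalSpace) rfl
  have hproj : ∀ x, (σ x).proj = x := fun x => congr_fun hσ x
  let v : X → G := fun x => Discrete.val (α := G) (σ x).snd
  have hcont : ∀ i, ∃ c, ∀ᶠ x in 𝓝 i, v x * s x x = c * s i x := by
    intro i
    have hc : ContinuousAt (fun x => (Z.localTriv i (σ x)).2) i := by
      have h1 : ContinuousAt (Z.localTriv i) (σ i) := by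
        refine (Z.localTriv i).continuousOn.continuousAt
          ((Z.localTriv i).open_source.mem_nhds ?_)
        rw [(Z.localTriv i).mem_source]
        change (σ i).proj ∈ U i
        rw [hproj]
        exact hmem i
      exact (ContinuousAt.comp (g := Z.localTriv i) (f := σ) h1 σ.continuous.continuousAt).snd
    have h2 : ∀ x, (Z.localTriv i (σ x)).2 = Discrete.mk (v x * (s x x * (s i x)⁻¹)) := by
      intro x
      rw [Z.localTriv_apply]
      change Discrete.mk (v x * (s (σ x).proj (σ x).proj * (s i (σ x).proj)⁻¹)) = _
      rw [hproj]
    refine ⟨v i * (s i i * (s i i)⁻¹), ?_⟩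
    have h3 : ∀ᶠ x in 𝓝 i, (Z.localTriv i (σ x)).2 = (Z.localTriv i (σ i)).2 := by
      refine hc.eventually (show ∀ᶠ w in 𝓝 ((Z.localTriv i (σ i)).2),
        w = (Z.localTriv i (σ i)).2 from ?_)
      rw [nhds_discrete]
      exact eventually_pure.2 rfl
    filter_upwards [h3, (hU i).mem_nhds (hmem i)] with x hx hxU
    rw [h2, h2, Discrete.mk.injEq] at hx
    rw [← hx, mul_assoc, mul_assoc, inv_mul_cancel₀ (hs i x hxU), mul_one]
  have h0 : v p₀ * s p₀ p₀ = 1 := by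
    have : ∀ y : Z.TotalSpace, y = (⟨p₀, Discrete.mk (s p₀ p₀)⁻¹⟩ : Z.TotalSpace) →
        Discrete.val (α := G) y.snd = (s p₀ p₀)⁻¹ := by rintro y rfl; rfl
    rw [show v p₀ = (s p₀ p₀)⁻¹ from this _ hσ0, inv_mul_cancel₀ (hs p₀ p₀ (hmem p₀))]
  refine ⟨fun x => v x * s x x, ⟨p₀, h0⟩, ?_, hcont⟩
  -- Near each point the section is `c * s i` with `s i` nowhere zero, so whether it vanishes is
  -- locally constant; it is `1` at `p₀`.
  have hlc : IsLocallyConstant (fun x => v x * s x x = 0) := by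
    rw [IsLocallyConstant.iff_eventually_eq]
    intro i
    obtain ⟨c, hc⟩ := hcont i
    filter_upwards [hc, (hU i).mem_nhds (hmem i)] with x hx hxU
    rw [hx, hc.self_of_nhds]
    simp [hs i x hxU, hs i i (hmem i)]
  intro p hp
  have := hlc.apply_eq_of_preconnectedSpace p p₀
  simp only [hp, h0, one_ne_zero, eq_iff_iff, iff_false, not_true_eq_false] at this

end Gluing

/-! ### Changes of complex charts -/

section Transition

variable {X : Type*} [TopologicalSpace X] [ChartedSpace ℂ X]

theorem contDiffAt_transition [IsManifold 𝓘(ℂ) ω X] {e e' : OpenPartialHomeomorph X ℂ}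
    (he : e ∈ atlas ℂ X) (he' : e' ∈ atlas ℂ X) {p : X} (hp : p ∈ e.source)
    (hp' : p ∈ e'.source) : ContDiffAt ℂ ω (e' ∘ e.symm) (e p) := by
  have h : e.symm ≫ₕ e' ∈ contDiffGroupoid ω 𝓘(ℂ) := HasGroupoid.compatible he he'
  rw [contDiffGroupoid, mem_groupoid_of_pregroupoid, contDiffPregroupoid] at h
  have h1 := h.1
  simp only [modelWithCornersSelf_coe, modelWithCornersSelf_coe_symm, Function.comp_id,
    Function.id_comp, preimage_id, range_id, inter_univ] at h1
  refine (h1.contDiffAt ((e.symm ≫ₕ e').open_source.mem_nhds ?_))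
  simp [hp, hp']

omit [ChartedSpace ℂ X] in
theorem comp_symm_eventuallyEq {V : Type*} (f : X → V) {e e' : OpenPartialHomeomorph X ℂ} {p : X}
    (hp : p ∈ e.source) (hp' : p ∈ e'.source) :
    f ∘ e.symm =ᶠ[𝓝 (e p)] (f ∘ e'.symm) ∘ (e' ∘ e.symm) := by
  have : ∀ᶠ z in 𝓝 (e p), e.symm z ∈ e'.source :=
    (e.continuousAt_symm (e.map_source hp)).eventually
      (e'.open_source.mem_nhds (by rwa [e.left_inv hp]))
  filter_upwards [this] with z hz
  simp [e'.left_inv hz]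

/-- Chain rule for the change of charts. -/
theorem hasFDerivAt_change_chart [IsManifold 𝓘(ℂ) ω X] {V : Type*} [NormedAddCommGroup V]
    [NormedSpace ℝ V] {f : X → V} {e e' : OpenPartialHomeomorph X ℂ}
    (he : e ∈ atlas ℂ X) (he' : e' ∈ atlas ℂ X) {p : X} (hp : p ∈ e.source)
    (hp' : p ∈ e'.source) {T : ℂ →L[ℝ] V} (hf : HasFDerivAt (f ∘ e'.symm) T (e' p)) :
    HasFDerivAt (f ∘ e.symm) (T.comp (fderiv ℝ (e' ∘ e.symm) (e p))) (e p) := by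
  have hτ : DifferentiableAt ℝ (e' ∘ e.symm) (e p) :=
    ((contDiffAt_transition he he' hp hp').differentiableAt (by simp)).restrictScalars ℝ
  refine HasFDerivAt.congr_of_eventuallyEq ?_ (comp_symm_eventuallyEq f hp hp')
  refine HasFDerivAt.comp _ ?_ hτ.hasFDerivAt
  simpa [e.left_inv hp] using hf

/-- The differential of a change of complex charts is complex linear. -/
theorem fderiv_transition_mul_I [IsManifold 𝓘(ℂ) ω X] {e e' : OpenPartialHomeomorph X ℂ}
    (he : e ∈ atlas ℂ X) (he' : e' ∈ atlas ℂ X) {p : X} (hp : p ∈ e.source)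
    (hp' : p ∈ e'.source) (v : ℂ) :
    fderiv ℝ (e' ∘ e.symm) (e p) (Complex.I * v) =
      Complex.I * fderiv ℝ (e' ∘ e.symm) (e p) v := by
  have hτ : DifferentiableAt ℂ (e' ∘ e.symm) (e p) :=
    (contDiffAt_transition he he' hp hp').differentiableAt (by simp)
  rw [(hτ.hasFDerivAt.restrictScalars ℝ).fderiv]
  simp only [ContinuousLinearMap.coe_restrictScalars']
  rw [← smul_eq_mul, map_smul, smul_eq_mul]

end Transition

/-! ### Global parallel frames -/

section Global

variable {X : Type*} [TopologicalSpace X] [ChartedSpace ℂ X] [IsManifold 𝓘(ℂ) ω X]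
  {𝔸 : Type*} [NormedDivisionRing 𝔸] [NormedAlgebra ℝ 𝔸]

/-- `F` satisfies `dF = F θ` at the point `p`, in the coordinate `e`. -/
def IsParallelAt (θ : OpenPartialHomeomorph X ℂ → ℂ → ℂ →L[ℝ] 𝔸) (F : X → 𝔸)
    (e : OpenPartialHomeomorph X ℂ) (p : X) : Prop :=
  HasFDerivAt (F ∘ e.symm) (F p • θ e (e p)) (e p)

/-- The coordinate representations `θ e` are those of a one-form on the surface. -/
def IsOneForm {V : Type*} [NormedAddCommGroup V] [NormedSpace ℝ V]
    (θ : OpenPartialHomeomorph X ℂ → ℂ → ℂ →L[ℝ] V) : Prop :=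
  ∀ e ∈ atlas ℂ X, ∀ e' ∈ atlas ℂ X, ∀ p ∈ e.source, p ∈ e'.source →
    θ e (e p) = (θ e' (e' p)).comp (fderiv ℝ (e' ∘ e.symm) (e p))

variable {θ : OpenPartialHomeomorph X ℂ → ℂ → ℂ →L[ℝ] 𝔸}

theorem IsParallelAt.change_chart (hθ : IsOneForm θ) {F : X → 𝔸}
    {e e' : OpenPartialHomeomorph X ℂ} (he : e ∈ atlas ℂ X) (he' : e' ∈ atlas ℂ X) {p : X}
    (hp : p ∈ e.source) (hp' : p ∈ e'.source) (h : IsParallelAt θ F e' p) :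
    IsParallelAt θ F e p := by
  have := hasFDerivAt_change_chart he he' hp hp' h
  rw [IsParallelAt, hθ e he e' he' p hp hp']
  exact this

omit [ChartedSpace ℂ X] [IsManifold 𝓘(ℂ) ω X] in
theorem IsParallelAt.const_mul {F H : X → 𝔸} {e : OpenPartialHomeomorph X ℂ} {p : X}
    (hp : p ∈ e.source) (h : IsParallelAt θ F e p) {c : 𝔸} (hH : ∀ᶠ x in 𝓝 p, H x = c * F x) :
    IsParallelAt θ H e p := by
  have h1 : H ∘ e.symm =ᶠ[𝓝 (e p)] fun z => c * (F ∘ e.symm) z := by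
    have := (e.continuousAt_symm (e.map_source hp))
    rw [ContinuousAt, e.left_inv hp] at this
    exact this.eventually hH
  refine HasFDerivAt.congr_of_eventuallyEq ?_ h1
  have h2 := HasFDerivAt.const_mul h c
  refine h2.congr_fderiv ?_
  rw [hH.self_of_nhds, smul_smul]

omit [ChartedSpace ℂ X] [IsManifold 𝓘(ℂ) ω X] in
/-- Two parallel frames differ by a locally constant left factor. -/
theorem eventually_mul_inv_eq {F H : X → 𝔸} {e : OpenPartialHomeomorph X ℂ} {p : X}
    (hp : p ∈ e.source)
    (hF : ∀ᶠ x in 𝓝 p, IsParallelAt θ F e x)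
    (hH : ∀ᶠ x in 𝓝 p, IsParallelAt θ H e x ∧ H x ≠ 0) :
    ∀ᶠ y in 𝓝 p, F y * (H y)⁻¹ = F p * (H p)⁻¹ := by
  have hsymm := e.continuousAt_symm (e.map_source hp)
  rw [ContinuousAt, e.left_inv hp] at hsymm
  have htgt : ∀ᶠ z in 𝓝 (e p), z ∈ e.target := e.open_target.mem_nhds (e.map_source hp)
  obtain ⟨r, hr, hball⟩ := Metric.eventually_nhds_iff_ball.1
    (htgt.and (hsymm.eventually (hF.and hH)))
  have hder : ∀ z ∈ ball (e p) r,
      HasFDerivAt (fun z => F (e.symm z) * (H (e.symm z))⁻¹) (0 : ℂ →L[ℝ] 𝔸) z := by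
    intro z hz
    obtain ⟨hzt, h1, h2, h3⟩ := hball z hz
    rw [IsParallelAt, e.right_inv hzt] at h1 h2
    have h4 : HasFDerivAt (fun z => (H (e.symm z))⁻¹) _ z :=
      (hasFDerivAt_inv' (𝕜 := ℝ) h3).comp z h2
    -- The derivative of `F * H⁻¹` is `F θ H⁻¹ - F H⁻¹ (H θ) H⁻¹ = 0`.
    refine (h1.mul' h4).congr_fderiv ?_
    ext v
    simp [mul_assoc, h3]
  have hconst : ∀ z ∈ ball (e p) r, F (e.symm z) * (H (e.symm z))⁻¹ =
      F (e.symm (e p)) * (H (e.symm (e p)))⁻¹ := by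
    intro z hz
    exact isOpen_ball.is_const_of_fderiv_eq_zero (𝕜 := ℝ)
      (convex_ball (e p) r).isPreconnected
      (fun y hy => (hder y hy).differentiableAt.differentiableWithinAt)
      (fun y hy => (hder y hy).fderiv) hz (mem_ball_self hr)
  filter_upwards [(e.continuousAt hp).eventually (ball_mem_nhds _ hr),
    e.open_source.mem_nhds hp] with y hy hys
  have := hconst _ hy
  rwa [e.left_inv hys, e.left_inv hp] at this

/-- On a simply connected surface, a flat connection form has a global parallel frame. -/
theorem exists_global_parallel [CompleteSpace 𝔸] [SimplyConnectedSpace X] (hθ : IsOneForm θ)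
    (hsm : ∀ e ∈ atlas ℂ X, ∀ ζ ∈ e.target, ContDiffAt ℝ 2 (θ e) ζ)
    (flat : ∀ e ∈ atlas ℂ X, ∀ ζ ∈ e.target, ∀ u v,
      fderiv ℝ (θ e) ζ u v + θ e ζ u * θ e ζ v = fderiv ℝ (θ e) ζ v u + θ e ζ v * θ e ζ u) :
    ∃ F : X → 𝔸, (∃ p, F p = 1) ∧ (∀ p, F p ≠ 0) ∧
      ∀ e ∈ atlas ℂ X, ∀ ζ ∈ e.target, HasFDerivAt (F ∘ e.symm) (F (e.symm ζ) • θ e ζ) ζ := by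
  have hloc : ∀ i : X, ∃ s : X → 𝔸, ∃ U : Set X, IsOpen U ∧ i ∈ U ∧
      ∀ x ∈ U, x ∈ (chartAt ℂ i).source ∧ s x ≠ 0 ∧ IsParallelAt θ s (chartAt ℂ i) x := by
    intro i
    set e := chartAt ℂ i
    have he : e ∈ atlas ℂ X := chart_mem_atlas ℂ i
    have hi : i ∈ e.source := mem_chart_source ℂ i
    obtain ⟨F, hF1, hF⟩ := exists_local_parallel (hsm e he _ (e.map_source hi))
      (by filter_upwards [e.open_target.mem_nhds (e.map_source hi)] with ζ hζ
          exact flat e he ζ hζ)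
    have hne : ∀ᶠ z in 𝓝 (e i), F z ≠ 0 :=
      hF.self_of_nhds.continuousAt.eventually_ne (by rw [hF1]; exact one_ne_zero)
    have h1 : ∀ᶠ x in 𝓝 i, x ∈ e.source ∧ F (e x) ≠ 0 ∧ IsParallelAt θ (F ∘ e) e x := by
      filter_upwards [e.open_source.mem_nhds hi, (e.continuousAt hi).eventually hne,
        (e.continuousAt hi).eventually hF] with x hx hx1 hx2
      refine ⟨hx, hx1, ?_⟩
      refine HasFDerivAt.congr_of_eventuallyEq hx2 ?_
      filter_upwards [e.open_target.mem_nhds (e.map_source hx)] with z hz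
      simp [e.right_inv hz]
    obtain ⟨U, hU, hUo, hiU⟩ := eventually_nhds_iff.1 h1
    exact ⟨F ∘ e, U, hUo, hiU, fun x hx => hU x hx⟩
  choose s U hUo hiU hU using hloc
  have : LocallyPathConnectedSpace X := ChartedSpace.locallyPathConnectedSpace ℂ X
  obtain ⟨F, hF1, hF0, hF⟩ := exists_glued_section U hUo hiU s (fun i x hx => (hU i x hx).2.1)
    (fun i j x hx => by
      refine eventually_mul_inv_eq (θ := θ) (hU i x hx.1).1 ?_ ?_
      · filter_upwards [(hUo i).mem_nhds hx.1] with y hy using (hU i y hy).2.2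
      · filter_upwards [(hUo i).mem_nhds hx.1, (hUo j).mem_nhds hx.2] with y hy hy'
        exact ⟨(hU j y hy').2.2.change_chart hθ (chart_mem_atlas ℂ i) (chart_mem_atlas ℂ j)
          (hU i y hy).1 (hU j y hy').1, (hU j y hy').2.1⟩)
  refine ⟨F, hF1, hF0, fun e he ζ hζ => ?_⟩
  set p := e.symm ζ with hp
  have hps : p ∈ e.source := e.map_target hζ
  obtain ⟨c, hc⟩ := hF p
  have h1 : IsParallelAt θ F (chartAt ℂ p) p :=
    (hU p p (hiU p)).2.2.const_mul (hU p p (hiU p)).1 hc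
  have h2 := h1.change_chart hθ he (chart_mem_atlas ℂ p) hps (mem_chart_source ℂ p)
  rw [IsParallelAt, hp, e.right_inv hζ] at h2
  exact h2

end Global

/-! ### Imaginary quaternions as Euclidean three-space -/

section Quaternions

/-- The Lie algebra as the space of imaginary quaternions. -/
def toQuat : E3 →L[ℝ] ℍ[ℝ] :=
  LinearMap.toContinuousLinearMap
    { toFun := fun v => ⟨0, v 0, v 1, v 2⟩
      map_add' := fun v w =>
        QuaternionAlgebra.ext (show (0 : ℝ) = 0 + 0 by simp) rfl rfl rfl
      map_smul' := fun c v =>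
        QuaternionAlgebra.ext (show (0 : ℝ) = c * 0 by simp) rfl rfl rfl }

/-- The imaginary part of a quaternion. -/
def ofQuat : ℍ[ℝ] →L[ℝ] E3 :=
  LinearMap.toContinuousLinearMap
    { toFun := fun q => !₂[q.imI, q.imJ, q.imK]
      map_add' := fun v w => by ext i; fin_cases i <;> simp
      map_smul' := fun c v => by ext i; fin_cases i <;> simp }

theorem ofQuat_apply (q : ℍ[ℝ]) : ofQuat q = !₂[q.imI, q.imJ, q.imK] := rfl

@[simp] theorem toQuat_re (v : E3) : (toQuat v).re = 0 := rfl
@[simp] theorem toQuat_imI (v : E3) : (toQuat v).imI = v 0 := rfl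
@[simp] theorem toQuat_imJ (v : E3) : (toQuat v).imJ = v 1 := rfl
@[simp] theorem toQuat_imK (v : E3) : (toQuat v).imK = v 2 := rfl

@[simp] theorem ofQuat_toQuat (v : E3) : ofQuat (toQuat v) = v := by
  ext i; fin_cases i <;> simp [ofQuat_apply]

theorem toQuat_ofQuat {q : ℍ[ℝ]} (hq : q.re = 0) : toQuat (ofQuat q) = q := by
  ext <;> simp [ofQuat_apply, hq]

theorem leftTranslate_eq (q v : ℍ[ℝ]) : leftTranslate q v = ofQuat (q⁻¹ * v) := rfl

theorem inner_E3 (a b : E3) : inner ℝ a b = a 0 * b 0 + a 1 * b 1 + a 2 * b 2 := by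
  simp [PiLp.inner_apply, Fin.sum_univ_three, mul_comm]

theorem inner_quat (p q : ℍ[ℝ]) :
    inner ℝ p q = p.re * q.re + p.imI * q.imI + p.imJ * q.imJ + p.imK * q.imK := by
  simp [Quaternion.inner_def]

theorem inner_toQuat (a b : E3) : inner ℝ (toQuat a) (toQuat b) = inner ℝ a b := by
  simp [inner_quat, inner_E3]

theorem inner_mul_left_quat (q a b : ℍ[ℝ]) :
    inner ℝ (q * a) (q * b) = ‖q‖ ^ 2 * inner ℝ a b := by
  rw [← real_inner_self_eq_norm_sq]
  simp only [inner_quat, Quaternion.re_mul, Quaternion.imI_mul, Quaternion.imJ_mul,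
    Quaternion.imK_mul]
  ring

theorem re_star_mul (p q : ℍ[ℝ]) : (star p * q).re = inner ℝ p q := by
  rw [inner_quat]
  simp

theorem star_mul_self_of_norm_eq_one {q : ℍ[ℝ]} (hq : ‖q‖ = 1) : star q * q = 1 := by
  rw [Quaternion.star_mul_self, Quaternion.normSq_eq_norm_mul_self, hq]; simp

theorem self_mul_star_of_norm_eq_one {q : ℍ[ℝ]} (hq : ‖q‖ = 1) : q * star q = 1 := by
  rw [Quaternion.self_mul_star, Quaternion.normSq_eq_norm_mul_self, hq]; simp

theorem inv_eq_star_of_norm_eq_one {q : ℍ[ℝ]} (hq : ‖q‖ = 1) : q⁻¹ = star q :=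
  inv_eq_of_mul_eq_one_left (star_mul_self_of_norm_eq_one hq)

theorem toQuat_mul_self {n : E3} (hn : ‖n‖ = 1) : toQuat n * toQuat n = -1 := by
  have h : n 0 * n 0 + n 1 * n 1 + n 2 * n 2 = 1 := by
    rw [← inner_E3, real_inner_self_eq_norm_sq, hn]; norm_num
  ext
  · simp; linarith
  all_goals (simp; try ring)

theorem vol3_eq (a b c : E3) : vol3 a b c = a 0 * (b 1 * c 2 - b 2 * c 1) -
    a 1 * (b 0 * c 2 - b 2 * c 0) + a 2 * (b 0 * c 1 - b 1 * c 0) := by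
  simp [vol3, Matrix.det_fin_three]
  ring

end Quaternions

/-! ### The Weingarten equation at a point -/

section Pointwise

theorem map_complex_eq {V : Type*} [AddCommGroup V] [Module ℝ V] [TopologicalSpace V]
    (T : ℂ →L[ℝ] V) (v : ℂ) : T v = v.re • T 1 + v.im • T Complex.I := by
  conv_lhs => rw [← Complex.re_add_im v]
  rw [← map_smul, ← map_smul, ← map_add]
  congr 1
  simp [mul_comm]

theorem det_complex_eq (S : ℂ →ₗ[ℝ] ℂ) :
    LinearMap.det S = (S 1).re * (S Complex.I).im - (S 1).im * (S Complex.I).re := by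
  rw [← LinearMap.det_toMatrix Complex.basisOneI, Matrix.det_fin_two]
  simp [LinearMap.toMatrix_apply]
  ring

/-- This is Cramer's rule. It serves to verify vector identities by pairing them with the two
tangent vectors and the normal. -/
theorem eq_zero_of_inner_eq_zero {a b c u : E3} (hv : vol3 a b c ≠ 0) (ha : inner ℝ u a = 0)
    (hb : inner ℝ u b = 0) (hc : inner ℝ u c = 0) : u = 0 := by
  rw [inner_E3] at ha hb hc
  have h : ∀ i, vol3 a b c * u i = 0 := by
    rw [vol3_eq]
    intro i
    fin_cases i <;> simp only [Fin.zero_eta, Fin.mk_one, Fin.reduceFinMk]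
    · linear_combination (b 1 * c 2 - b 2 * c 1) * ha + (c 1 * a 2 - c 2 * a 1) * hb +
        (a 1 * b 2 - a 2 * b 1) * hc
    · linear_combination (b 2 * c 0 - b 0 * c 2) * ha + (c 2 * a 0 - c 0 * a 2) * hb +
        (a 2 * b 0 - a 0 * b 2) * hc
    · linear_combination (b 0 * c 1 - b 1 * c 0) * ha + (c 0 * a 1 - c 1 * a 0) * hb +
        (a 0 * b 1 - a 1 * b 0) * hc
  ext i
  exact (mul_eq_zero.1 (h i)).resolve_left hv

/-- The cross product. -/
def cross (a b : E3) : E3 :=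
  !₂[a 1 * b 2 - a 2 * b 1, a 2 * b 0 - a 0 * b 2, a 0 * b 1 - a 1 * b 0]

@[simp] theorem cross_zero' (a b : E3) : cross a b 0 = a 1 * b 2 - a 2 * b 1 := rfl
@[simp] theorem cross_one' (a b : E3) : cross a b 1 = a 2 * b 0 - a 0 * b 2 := rfl
@[simp] theorem cross_two' (a b : E3) : cross a b 2 = a 0 * b 1 - a 1 * b 0 := rfl

theorem toQuat_mul_toQuat {a b : E3} (h : inner ℝ a b = 0) :
    toQuat a * toQuat b = toQuat (cross a b) := by
  rw [inner_E3] at h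
  ext
  · simp; linarith
  all_goals (simp; try ring)

theorem toQuat_injective : Function.Injective toQuat :=
  Function.LeftInverse.injective ofQuat_toQuat

variable {n : E3} {T D : ℂ →L[ℝ] E3}

/-- The Weingarten equation in a conformal coordinate of the second fundamental form. -/
theorem weingarten_of_conformal {K : ℝ} (hn : ‖n‖ = 1) (hT : ∀ v, inner ℝ n (T v) = 0)
    (hD : ∀ v, inner ℝ n (D v) = 0) (hc : ConformalSecondForm T D)
    (hv : 0 < vol3 (T 1) (T Complex.I) n) (hS : ShapeDet T D K) :
    0 < K ∧ K = vol3 (D 1) (D Complex.I) n / vol3 (T 1) (T Complex.I) n ∧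
      ∀ v, toQuat (D v) = √K • (toQuat n * toQuat (T (Complex.I * v))) := by
  obtain ⟨ρ, hρ, hII⟩ := hc
  obtain ⟨S, hS, hdet⟩ := hS
  set A := vol3 (T 1) (T Complex.I) n with hA
  have hA' := hA
  have h11 := hII 1 1
  have h1I := hII 1 Complex.I
  have hI1 := hII Complex.I 1
  have hII' := hII Complex.I Complex.I
  have hn1 : inner ℝ n n = (1 : ℝ) := by rw [real_inner_self_eq_norm_sq, hn]; norm_num
  have hT1 := hT 1
  have hTI := hT Complex.I
  have hD1 := hD 1
  have hDI := hD Complex.I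
  simp only [secondForm, inner_neg_left] at h11 h1I hI1 hII'
  simp at h11 h1I hI1 hII'
  -- Pairing `n × T(i)` with `T 1` gives the area element `A` up to sign, so this scale makes the
  -- pairing of `D 1` with `T 1` equal to `-2ρ`. It turns out to be `√K`.
  set μ := 2 * ρ / A with hμ
  have hμA : μ * A = 2 * ρ := by rw [hμ]; field_simp
  have hμ0 : 0 < μ := by positivity
  rw [inner_E3] at h11 h1I hI1 hII' hn1 hT1 hTI hD1 hDI
  rw [vol3_eq] at hA'
  have e1 : D 1 = μ • cross n (T Complex.I) := by
    rw [← sub_eq_zero]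
    apply eq_zero_of_inner_eq_zero (hA ▸ hv.ne')
    · rw [inner_E3]; simp; linear_combination -h11 + hμA - μ * hA'
    · rw [inner_E3]; simp; linear_combination h1I
    · rw [inner_E3]; simp; linear_combination hD1
  have eI : D Complex.I = -μ • cross n (T 1) := by
    rw [← sub_eq_zero]
    apply eq_zero_of_inner_eq_zero (hA ▸ hv.ne')
    · rw [inner_E3]; simp; linear_combination hI1
    · rw [inner_E3]; simp; linear_combination -hII' + hμA - μ * hA'
    · rw [inner_E3]; simp; linear_combination hDI
  -- Applying the shape operator multiplies the tangential area by its determinant, and the two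
  -- minus signs cancel.
  have hKA : vol3 (D 1) (D Complex.I) n = K * A := by
    rw [det_complex_eq] at hdet
    have s1 := hS 1
    have sI := hS Complex.I
    rw [map_complex_eq T (S 1)] at s1
    rw [map_complex_eq T (S Complex.I)] at sI
    rw [eq_neg_iff_add_eq_zero, ← eq_neg_iff_add_eq_zero, eq_comm, neg_eq_iff_eq_neg] at s1 sI
    rw [s1, sI, ← hdet, hA, vol3_eq, vol3_eq]
    simp
    ring
  have hμK : vol3 (D 1) (D Complex.I) n = μ ^ 2 * A := by
    rw [e1, eI, vol3_eq, hA']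
    simp
    linear_combination μ ^ 2 * ((T 1) 0 * ((T Complex.I) 1 * n 2 - (T Complex.I) 2 * n 1) -
      (T 1) 1 * ((T Complex.I) 0 * n 2 - (T Complex.I) 2 * n 0) +
      (T 1) 2 * ((T Complex.I) 0 * n 1 - (T Complex.I) 1 * n 0)) * hn1
  have hK : K = μ ^ 2 := by
    have : K * A = μ ^ 2 * A := by rw [← hKA, hμK]
    exact mul_right_cancel₀ hv.ne' this
  have hsq : √K = μ := by rw [hK, Real.sqrt_sq hμ0.le]
  refine ⟨by rw [hK]; positivity, by rw [hKA]; field_simp, fun v => ?_⟩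
  rw [toQuat_mul_toQuat (hT _), ← map_smul, hsq]
  congr 1
  rw [map_complex_eq D v, map_complex_eq T (Complex.I * v), e1, eI]
  ext i
  fin_cases i <;> simp <;> ring

/-- The converse of the Weingarten equation: it determines the second fundamental form and the
extrinsic curvature. -/
theorem conformal_of_weingarten {k : ℝ} (hn : ‖n‖ = 1) (hT : ∀ v, inner ℝ n (T v) = 0)
    (hv : 0 < vol3 (T 1) (T Complex.I) n) (hk : 0 < k)
    (hD : ∀ v, toQuat (D v) = k • (toQuat n * toQuat (T (Complex.I * v)))) :
    ConformalSecondForm T D ∧ ShapeDet T D (k ^ 2) := by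
  set A := vol3 (T 1) (T Complex.I) n with hA
  have hA' := hA
  rw [vol3_eq] at hA'
  have hn1 : inner ℝ n n = (1 : ℝ) := by rw [real_inner_self_eq_norm_sq, hn]; norm_num
  have hT1 := hT 1
  have hTI := hT Complex.I
  have hcr : cross (T 1) (T Complex.I) = A • n := by
    rw [← sub_eq_zero]
    rw [inner_E3] at hn1 hT1 hTI
    apply eq_zero_of_inner_eq_zero (hA ▸ hv.ne')
    · rw [inner_E3]; simp; linear_combination -A * hT1
    · rw [inner_E3]; simp; linear_combination -A * hTI
    · rw [inner_E3]; simp; linear_combination -A * hn1 - hA'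
  have hD' : ∀ v, D v = k • cross n (T (Complex.I * v)) := by
    intro v
    apply toQuat_injective
    rw [hD, toQuat_mul_toQuat (hT _), ← map_smul]
  have c0 := congr_arg (fun v : E3 => v 0) hcr
  have c1 := congr_arg (fun v : E3 => v 1) hcr
  have c2 := congr_arg (fun v : E3 => v 2) hcr
  simp at c0 c1 c2
  rw [inner_E3] at hn1 hT1 hTI
  constructor
  -- The pairing `⟨-k n × T(i v), T w⟩` is `k A Re(v w̄)`, so `2ρ = k A`.
  · refine ⟨k * A / 2, by positivity, fun v w => ?_⟩
    rw [secondForm, hD', map_complex_eq T (Complex.I * v), map_complex_eq T w, inner_neg_left,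
      inner_E3, hA']
    simp
    ring
  · set E := inner ℝ (T 1) (T 1) with hE
    set F := inner ℝ (T 1) (T Complex.I) with hF
    set G := inner ℝ (T Complex.I) (T Complex.I) with hG
    rw [inner_E3] at hE hF hG
    have hgram : E * G - F ^ 2 = A ^ 2 := by
      rw [hE, hF, hG]
      linear_combination ((T 1) 1 * (T Complex.I) 2 - (T 1) 2 * (T Complex.I) 1 + A * n 0) * c0 +
        ((T 1) 2 * (T Complex.I) 0 - (T 1) 0 * (T Complex.I) 2 + A * n 1) * c1 +
        ((T 1) 0 * (T Complex.I) 1 - (T 1) 1 * (T Complex.I) 0 + A * n 2) * c2 + A ^ 2 * hn1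
    have hA0 : A ≠ 0 := hv.ne'
    -- The shape operator has matrix `(k / A)` times the adjugate of the Gram matrix with entries
    -- `E, F, G`; its determinant is `k²` because `E G - F² = A²`.
    obtain ⟨p, hp⟩ : ∃ p, p * A = k * G := ⟨k * G / A, by field_simp⟩
    obtain ⟨q, hq⟩ : ∃ q, q * A = k * F := ⟨k * F / A, by field_simp⟩
    obtain ⟨r, hr⟩ : ∃ r, r * A = k * E := ⟨k * E / A, by field_simp⟩
    let s₁ : ℂ := ⟨p, -q⟩
    let s₂ : ℂ := ⟨-q, r⟩
    let S : ℂ →ₗ[ℝ] ℂ :=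
      { toFun := fun v => v.re • s₁ + v.im • s₂
        map_add' := fun v w => by simp only [Complex.add_re, Complex.add_im, add_smul]; abel
        map_smul' := fun c v => by simp [mul_assoc] }
    have hS1 : S 1 = s₁ := by simp [S]
    have hSI : S Complex.I = s₂ := by simp [S]
    refine ⟨S, fun v => ?_, ?_⟩
    · have e : S v = v.re • s₁ + v.im • s₂ := rfl
      rw [e, map_add, map_smul, map_smul, map_complex_eq T s₁, map_complex_eq T s₂, hD',
        map_complex_eq T (Complex.I * v)]
      rw [hG] at hp
      rw [hF] at hq
      rw [hE] at hr
      ext i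
      apply mul_left_cancel₀ hA0
      fin_cases i
      · simp [s₁, s₂]
        linear_combination (v.re * (T 1) 0) * hp - (v.im * (T 1) 0 + v.re * (T Complex.I) 0) * hq +
          (v.im * (T Complex.I) 0) * hr -
          k * (v.re * (T Complex.I) 2 - v.im * (T 1) 2) * c1 +
          k * (v.re * (T Complex.I) 1 - v.im * (T 1) 1) * c2
      · simp [s₁, s₂]
        linear_combination (v.re * (T 1) 1) * hp - (v.im * (T 1) 1 + v.re * (T Complex.I) 1) * hq +
          (v.im * (T Complex.I) 1) * hr -
          k * (v.re * (T Complex.I) 0 - v.im * (T 1) 0) * c2 +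
          k * (v.re * (T Complex.I) 2 - v.im * (T 1) 2) * c0
      · simp [s₁, s₂]
        linear_combination (v.re * (T 1) 2) * hp - (v.im * (T 1) 2 + v.re * (T Complex.I) 2) * hq +
          (v.im * (T Complex.I) 2) * hr -
          k * (v.re * (T Complex.I) 1 - v.im * (T 1) 1) * c0 +
          k * (v.re * (T Complex.I) 0 - v.im * (T 1) 0) * c1
    · rw [det_complex_eq, hS1, hSI]
      apply mul_left_cancel₀ (mul_ne_zero hA0 hA0)
      change A * A * (p * r - -q * -q) = A * A * k ^ 2
      linear_combination (r * A) * hp - (q * A + k * F) * hq + (k * G) * hr + k ^ 2 * hgram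

end Pointwise

/-! ### Invariance under linear isometric embeddings -/

section Transfer

variable {V W : Type*} [NormedAddCommGroup V] [InnerProductSpace ℝ V]
  [NormedAddCommGroup W] [InnerProductSpace ℝ W]

theorem conformalSecondForm_comp_iff (L : V →L[ℝ] W)
    (hL : ∀ a b, inner ℝ (L a) (L b) = inner ℝ a b) (T D : ℂ →L[ℝ] V) :
    ConformalSecondForm (L.comp T) (L.comp D) ↔ ConformalSecondForm T D := by
  simp [ConformalSecondForm, secondForm, hL]

theorem shapeDet_comp_iff (L : V →L[ℝ] W)
    (hL : ∀ a b, inner ℝ (L a) (L b) = inner ℝ a b) (T D : ℂ →L[ℝ] V) (k : ℝ) :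
    ShapeDet (L.comp T) (L.comp D) k ↔ ShapeDet T D k := by
  have hinj : Function.Injective L := by
    rw [injective_iff_map_eq_zero]
    intro a ha
    have := hL a a
    rw [ha, inner_zero_left] at this
    exact inner_self_eq_zero.1 this.symm
  simp only [ShapeDet, ContinuousLinearMap.comp_apply, ← map_neg, hinj.eq_iff]

end Transfer

/-! ### Closedness and flatness tested on the pair `1, i` -/

section Symmetry

variable {V : Type*} [NormedAddCommGroup V] [NormedSpace ℝ V]

theorem bilinear_symm_iff (B : ℂ →L[ℝ] ℂ →L[ℝ] V) :
    (∀ u v, B u v = B v u) ↔ B 1 Complex.I = B Complex.I 1 := by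
  refine ⟨fun h => h _ _, fun h u v => ?_⟩
  rw [map_complex_eq (B u) v, map_complex_eq (B v) u, map_complex_eq B u, map_complex_eq B v]
  simp only [add_apply, smul_apply, h]
  module

/-- Flatness says that the bilinear map `B + T ⊗ T` is symmetric, and on a real plane symmetry need
only be checked on one basis pair. -/
theorem flat_iff {𝔸 : Type*} [NormedRing 𝔸] [NormedAlgebra ℝ 𝔸] (B : ℂ →L[ℝ] ℂ →L[ℝ] 𝔸)
    (T : ℂ →L[ℝ] 𝔸) : (∀ u v, B u v + T u * T v = B v u + T v * T u) ↔
      B 1 Complex.I - B Complex.I 1 = T Complex.I * T 1 - T 1 * T Complex.I := by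
  have h := bilinear_symm_iff (B + (ContinuousLinearMap.mul ℝ 𝔸).bilinearComp T T)
  simp only [add_apply, ContinuousLinearMap.bilinearComp_apply,
    ContinuousLinearMap.mul_apply'] at h
  rw [h, sub_eq_sub_iff_add_eq_add, add_comm (T _ * T _)]

end Symmetry

/-! ### Curl and commutator of the forms `a n dn + b n (dn ∘ i)` -/

section GaussForm

/-- Multiplication by the imaginary unit. -/
def mulI : ℂ →L[ℝ] ℂ := ContinuousLinearMap.mul ℝ ℂ Complex.I

@[simp] theorem mulI_apply (v : ℂ) : mulI v = Complex.I * v := rfl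

/-- The quaternion valued one-form `a n dn + b n (dn ∘ i)`. -/
def gaussForm (n : ℂ → ℍ[ℝ]) (a b : ℂ → ℝ) (z : ℂ) : ℂ →L[ℝ] ℍ[ℝ] :=
  a z • (ContinuousLinearMap.mul ℝ ℍ[ℝ] (n z)).comp (fderiv ℝ n z) +
    b z • (ContinuousLinearMap.mul ℝ ℍ[ℝ] (n z)).comp ((fderiv ℝ n z).comp mulI)

@[simp] theorem gaussForm_apply (n : ℂ → ℍ[ℝ]) (a b : ℂ → ℝ) (z v : ℂ) :
    gaussForm n a b z v =
      a z • (n z * fderiv ℝ n z v) + b z • (n z * fderiv ℝ n z (Complex.I * v)) := rfl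

variable {n : ℂ → ℍ[ℝ]} {a b : ℂ → ℝ} {ζ : ℂ}

theorem contDiffAt_gaussForm (hn : ContDiffAt ℝ ∞ n ζ) (ha : ContDiffAt ℝ ∞ a ζ)
    (hb : ContDiffAt ℝ ∞ b ζ) : ContDiffAt ℝ ∞ (gaussForm n a b) ζ := by
  have h1 : ContDiffAt ℝ ∞ (fderiv ℝ n) ζ := hn.fderiv_right (by simp)
  have h2 : ContDiffAt ℝ ∞ (fun z => ContinuousLinearMap.mul ℝ ℍ[ℝ] (n z)) ζ :=
    (ContinuousLinearMap.mul ℝ ℍ[ℝ]).contDiff.contDiffAt.comp ζ hn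
  exact (ha.smul (h2.clm_comp h1)).add (hb.smul (h2.clm_comp (h1.clm_comp contDiffAt_const)))

/-- The tension of the Gauss map, up to a real part. -/
def tension (n : ℂ → ℍ[ℝ]) (ζ : ℂ) : ℍ[ℝ] :=
  fderiv ℝ n ζ 1 * fderiv ℝ n ζ 1 + fderiv ℝ n ζ Complex.I * fderiv ℝ n ζ Complex.I +
    n ζ * (fderiv ℝ (fderiv ℝ n) ζ 1 1 + fderiv ℝ (fderiv ℝ n) ζ Complex.I Complex.I)

theorem fderiv_gaussForm_apply (hn : ContDiffAt ℝ 2 n ζ) (ha : DifferentiableAt ℝ a ζ)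
    (hb : DifferentiableAt ℝ b ζ) (hd : DifferentiableAt ℝ (gaussForm n a b) ζ) (u w : ℂ) :
    fderiv ℝ (gaussForm n a b) ζ u w =
      (fderiv ℝ a ζ u • (n ζ * fderiv ℝ n ζ w) +
        a ζ • (fderiv ℝ n ζ u * fderiv ℝ n ζ w + n ζ * fderiv ℝ (fderiv ℝ n) ζ u w)) +
      (fderiv ℝ b ζ u • (n ζ * fderiv ℝ n ζ (Complex.I * w)) +
        b ζ • (fderiv ℝ n ζ u * fderiv ℝ n ζ (Complex.I * w) +
          n ζ * fderiv ℝ (fderiv ℝ n) ζ u (Complex.I * w))) := by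
  have h1 := (hn.differentiableAt (by simp)).hasFDerivAt
  have h2 : HasFDerivAt (fderiv ℝ n) (fderiv ℝ (fderiv ℝ n) ζ) ζ :=
    ((hn.fderiv_right (m := 1) (by norm_num)).differentiableAt (by simp)).hasFDerivAt
  have h3 : ∀ w, HasFDerivAt (fun z => fderiv ℝ n z w)
      ((fderiv ℝ (fderiv ℝ n) ζ).flip w) ζ := by
    intro w
    refine (h2.clm_apply (hasFDerivAt_const w ζ)).congr_fderiv ?_
    refine ContinuousLinearMap.ext fun v => ?_
    simp
  have h4 := ((ha.hasFDerivAt.smul (h1.mul' (h3 w))).add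
    (hb.hasFDerivAt.smul (h1.mul' (h3 (Complex.I * w))))).fderiv
  have h5 := (hd.hasFDerivAt.clm_apply (hasFDerivAt_const w ζ)).fderiv
  have h6 : fderiv ℝ (fun z => gaussForm n a b z w) ζ u = fderiv ℝ (gaussForm n a b) ζ u w := by
    rw [h5]; simp
  rw [← h6]
  refine (DFunLike.congr_fun h4 u).trans ?_
  simp
  abel

/-- The mixed second derivatives of `n` cancel by symmetry. The rotated part contributes the pure
second derivatives through the tension, and the unrotated part contributes only a commutator. -/
theorem curl_gaussForm (hn : ContDiffAt ℝ 2 n ζ) (ha : DifferentiableAt ℝ a ζ)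
    (hb : DifferentiableAt ℝ b ζ) (hd : DifferentiableAt ℝ (gaussForm n a b) ζ) :
    fderiv ℝ (gaussForm n a b) ζ 1 Complex.I - fderiv ℝ (gaussForm n a b) ζ Complex.I 1 =
      (fderiv ℝ a ζ 1 - fderiv ℝ b ζ Complex.I) • (n ζ * fderiv ℝ n ζ Complex.I) -
        (fderiv ℝ b ζ 1 + fderiv ℝ a ζ Complex.I) • (n ζ * fderiv ℝ n ζ 1) -
        b ζ • tension n ζ +
        a ζ • (fderiv ℝ n ζ 1 * fderiv ℝ n ζ Complex.I -
          fderiv ℝ n ζ Complex.I * fderiv ℝ n ζ 1) := by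
  have hsymm : fderiv ℝ (fderiv ℝ n) ζ Complex.I 1 = fderiv ℝ (fderiv ℝ n) ζ 1 Complex.I :=
    (hn.isSymmSndFDerivAt (by simp)).eq _ _
  rw [fderiv_gaussForm_apply hn ha hb hd, fderiv_gaussForm_apply hn ha hb hd, hsymm,
    Complex.I_mul_I, mul_one, tension]
  simp only [map_neg, mul_neg, mul_add]
  module

/-- A map into the unit imaginary quaternions anticommutes with its differential. -/
theorem fderiv_mul_eq_neg (hn : DifferentiableAt ℝ n ζ) (hsq : ∀ᶠ z in 𝓝 ζ, n z * n z = -1)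
    (v : ℂ) : fderiv ℝ n ζ v * n ζ = -(n ζ * fderiv ℝ n ζ v) := by
  have h1 := (hn.hasFDerivAt.mul' hn.hasFDerivAt).fderiv
  have h2 : fderiv ℝ (n * n) ζ = 0 := by
    have : (n * n) =ᶠ[𝓝 ζ] fun _ => (-1 : ℍ[ℝ]) := hsq
    rw [this.fderiv_eq]; simp
  rw [h2] at h1
  have h3 := (DFunLike.congr_fun h1 v).symm
  simp at h3
  rw [eq_neg_iff_add_eq_zero, add_comm]
  exact h3

theorem mul_mul_mul_of_anticommute {n x y : ℍ[ℝ]} (hsq : n * n = -1) (hx : x * n = -(n * x)) :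
    n * x * (n * y) = x * y := by
  calc n * x * (n * y) = n * (x * n) * y := by simp only [mul_assoc]
    _ = -(n * n) * x * y := by rw [hx]; simp only [mul_assoc, mul_neg, neg_mul]
    _ = x * y := by rw [hsq]; simp

/-- Anticommutation removes both factors `n` from `(n x)(n y)`, and the pair `(a n_x + b n_y, a n_y
- b n_x)` is a rotation and dilation of `(n_x, n_y)`, which multiplies the commutator by `a² + b²`.
-/
theorem commutator_gaussForm (hn : DifferentiableAt ℝ n ζ)
    (hsq : ∀ᶠ z in 𝓝 ζ, n z * n z = -1) :
    gaussForm n a b ζ Complex.I * gaussForm n a b ζ 1 -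
        gaussForm n a b ζ 1 * gaussForm n a b ζ Complex.I =
      -(a ζ ^ 2 + b ζ ^ 2) • (fderiv ℝ n ζ 1 * fderiv ℝ n ζ Complex.I -
          fderiv ℝ n ζ Complex.I * fderiv ℝ n ζ 1) := by
  have hx := fderiv_mul_eq_neg hn hsq 1
  have hy := fderiv_mul_eq_neg hn hsq Complex.I
  simp only [gaussForm_apply, Complex.I_mul_I, mul_one, map_neg, mul_neg, add_mul, mul_add,
    smul_mul_smul_comm, smul_neg, neg_mul, mul_mul_mul_of_anticommute hsq.self_of_nhds hx,
    mul_mul_mul_of_anticommute hsq.self_of_nhds hy]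
  module

end GaussForm

/-! ### The curvature relation in real coordinates -/

section Relation

/-- The real form of the equation `(log Kstar)_z = (log ((i + k)⁴ / k²))_z`, where `L = log Kstar`
and `k` is the square root of the other curvature. -/
def RealRelation (k L : ℂ → ℝ) (ζ : ℂ) : Prop :=
  fderiv ℝ L ζ 1 * (k ζ * (1 + k ζ ^ 2)) =
      -2 * (fderiv ℝ k ζ 1 * (1 - k ζ ^ 2) + 2 * k ζ * fderiv ℝ k ζ Complex.I) ∧
    fderiv ℝ L ζ Complex.I * (k ζ * (1 + k ζ ^ 2)) =
      2 * (2 * k ζ * fderiv ℝ k ζ 1 - fderiv ℝ k ζ Complex.I * (1 - k ζ ^ 2))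

theorem hasFDerivAt_ofReal_comp {f : ℂ → ℝ} {ζ : ℂ} (hf : DifferentiableAt ℝ f ζ) :
    HasFDerivAt (fun w => (f w : ℂ)) (Complex.ofRealCLM.comp (fderiv ℝ f ζ)) ζ :=
  Complex.ofRealCLM.hasFDerivAt.comp ζ hf.hasFDerivAt

theorem dz_ofReal {f : ℂ → ℝ} {ζ : ℂ} (hf : DifferentiableAt ℝ f ζ) :
    dz (fun w => (f w : ℂ)) ζ =
      ((fderiv ℝ f ζ 1 : ℂ) - Complex.I * (fderiv ℝ f ζ Complex.I : ℂ)) / 2 := by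
  rw [dz, (hasFDerivAt_ofReal_comp hf).fderiv]
  simp

theorem dz_factor {k : ℂ → ℝ} {ζ : ℂ} (hk : DifferentiableAt ℝ k ζ) (h0 : 0 < k ζ) :
    dz (fun w => (Complex.I + (k w : ℂ)) ^ 4 / ((k w : ℂ) ^ 2)) ζ /
        ((Complex.I + (k ζ : ℂ)) ^ 4 / ((k ζ : ℂ) ^ 2)) =
      (4 / (Complex.I + k ζ) - 2 / k ζ) *
        (((fderiv ℝ k ζ 1 : ℂ) - Complex.I * (fderiv ℝ k ζ Complex.I : ℂ)) / 2) := by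
  have hk0 : (k ζ : ℂ) ≠ 0 := by exact_mod_cast h0.ne'
  have hI : Complex.I + (k ζ : ℂ) ≠ 0 := fun h => by
    have := congr_arg Complex.re h
    simp at this
    exact h0.ne' this
  have hG : HasDerivAt (fun z : ℂ => (Complex.I + z) ^ 4 / z ^ 2)
      ((Complex.I + k ζ) ^ 4 / (k ζ : ℂ) ^ 2 * (4 / (Complex.I + k ζ) - 2 / k ζ)) (k ζ : ℂ) := by
    have h1 := (((hasDerivAt_id (k ζ : ℂ)).const_add Complex.I).fun_pow 4).fun_div
      ((hasDerivAt_id (k ζ : ℂ)).fun_pow 2) (pow_ne_zero 2 hk0)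
    refine h1.congr_deriv ?_
    simp only [id]
    field_simp
    ring
  have h2 := (hG.hasFDerivAt.restrictScalars ℝ).comp ζ (hasFDerivAt_ofReal_comp hk)
  rw [dz, show (fun w => (Complex.I + (k w : ℂ)) ^ 4 / ((k w : ℂ) ^ 2)) =
    (fun z : ℂ => (Complex.I + z) ^ 4 / z ^ 2) ∘ fun w => (k w : ℂ) from rfl, h2.fderiv]
  simp
  field_simp

/-- The logarithmic derivative of `(i + k)⁴ / k²` with respect to `k` is `4/(i+k) - 2/k = 2 (k - i)²
/ (k (1 + k²))`; the two real equations are the real and imaginary parts after clearing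
denominators. -/
theorem realRelation_iff {k L : ℂ → ℝ} {ζ : ℂ} (hk : DifferentiableAt ℝ k ζ)
    (hL : DifferentiableAt ℝ L ζ) (h0 : 0 < k ζ) :
    dz (fun w => (L w : ℂ)) ζ =
        dz (fun w => (Complex.I + (k w : ℂ)) ^ 4 / ((k w : ℂ) ^ 2)) ζ /
          ((Complex.I + (k ζ : ℂ)) ^ 4 / ((k ζ : ℂ) ^ 2)) ↔ RealRelation k L ζ := by
  rw [dz_factor hk h0, dz_ofReal hL, RealRelation]
  have hk0 : (k ζ : ℂ) ≠ 0 := by exact_mod_cast h0.ne'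
  have hI : Complex.I + (k ζ : ℂ) ≠ 0 := fun h => by
    have := congr_arg Complex.re h
    simp at this
    exact h0.ne' this
  have hI' : (k ζ : ℂ) - Complex.I ≠ 0 := fun h => by
    have := congr_arg Complex.re h
    simp at this
    exact h0.ne' this
  generalize fderiv ℝ L ζ 1 = Lx
  generalize fderiv ℝ L ζ Complex.I = Ly
  generalize fderiv ℝ k ζ 1 = kx
  generalize fderiv ℝ k ζ Complex.I = ky
  generalize k ζ = k at *
  have e1 : (4 / (Complex.I + (k : ℂ)) - 2 / k) = 2 * (k - Complex.I) ^ 2 / (k * (1 + k ^ 2)) := by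
    have h : (1 + (k : ℂ) ^ 2) = (Complex.I + k) * (k - Complex.I) := by
      linear_combination Complex.I_sq
    rw [h]
    field_simp
    ring
  have h1 : (1 + (k : ℂ) ^ 2) ≠ 0 := by
    have : (0 : ℝ) < 1 + k ^ 2 := by positivity
    exact_mod_cast this.ne'
  have e2 : ((Lx : ℂ) - Complex.I * Ly) / 2 =
      (4 / (Complex.I + (k : ℂ)) - 2 / k) * ((kx - Complex.I * ky) / 2) ↔
      ((Lx : ℂ) - Complex.I * Ly) * (k * (1 + k ^ 2)) =
        2 * (k - Complex.I) ^ 2 * (kx - Complex.I * ky) := by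
    rw [e1]
    field_simp
  rw [e2, Complex.ext_iff]
  simp [pow_two]
  constructor
  · rintro ⟨h1, h2⟩
    constructor
    · linear_combination h1
    · linear_combination -h2
  · rintro ⟨h1, h2⟩
    constructor
    · linear_combination h1
    · linear_combination -h2

end Relation

/-! ### Equivalence of the two integrability conditions -/

section Integrability

variable {n : ℂ → ℍ[ℝ]} {k L : ℂ → ℝ} {ζ : ℂ}

/-- The left translated differential of a surface in the sphere with Gauss map `n` and extrinsic
curvature `k²`. -/
def sphereForm (n : ℂ → ℍ[ℝ]) (k : ℂ → ℝ) : ℂ → ℂ →L[ℝ] ℍ[ℝ] :=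
  gaussForm n (fun z => -1 / (1 + k z ^ 2)) (fun z => k z / (1 + k z ^ 2))

/-- The differential of a surface in Euclidean space with Gauss map `n` and extrinsic curvature
`exp L`. -/
def euclideanForm (n : ℂ → ℍ[ℝ]) (L : ℂ → ℝ) : ℂ → ℂ →L[ℝ] ℍ[ℝ] :=
  gaussForm n (fun _ => 0) (fun z => Real.exp (-(L z / 2)))

theorem contDiffAt_sphereForm (hn : ContDiffAt ℝ ∞ n ζ) (hk : ContDiffAt ℝ ∞ k ζ) :
    ContDiffAt ℝ ∞ (sphereForm n k) ζ := by
  have h : ∀ z, 1 + k z ^ 2 ≠ 0 := fun z => by positivity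
  have h1 : ContDiffAt ℝ ∞ (fun z => 1 + k z ^ 2) ζ := contDiffAt_const.add (hk.pow 2)
  exact contDiffAt_gaussForm hn (contDiffAt_const.div h1 (h ζ)) (hk.div h1 (h ζ))

theorem contDiffAt_euclideanForm (hn : ContDiffAt ℝ ∞ n ζ) (hL : ContDiffAt ℝ ∞ L ζ) :
    ContDiffAt ℝ ∞ (euclideanForm n L) ζ :=
  contDiffAt_gaussForm hn contDiffAt_const (hL.div_const 2).neg.exp

/-- The integrability conditions of the two forms agree. -/
theorem flat_sphereForm_iff (hn : ContDiffAt ℝ ∞ n ζ) (hsq : ∀ᶠ z in 𝓝 ζ, n z * n z = -1)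
    (hk : ContDiffAt ℝ ∞ k ζ) (hL : ContDiffAt ℝ ∞ L ζ) (h0 : 0 < k ζ)
    (hrel : RealRelation k L ζ) :
    (∀ u v, fderiv ℝ (sphereForm n k) ζ u v + sphereForm n k ζ u * sphereForm n k ζ v =
        fderiv ℝ (sphereForm n k) ζ v u + sphereForm n k ζ v * sphereForm n k ζ u) ↔
      ∀ u v, fderiv ℝ (euclideanForm n L) ζ u v = fderiv ℝ (euclideanForm n L) ζ v u := by
  have hn2 : ContDiffAt ℝ 2 n ζ := hn.of_le (WithTop.coe_le_coe.2 le_top)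
  have h1 : 1 + k ζ ^ 2 ≠ 0 := by positivity
  have dk := (hk.differentiableAt (by simp)).hasFDerivAt
  have dL := (hL.differentiableAt (by simp)).hasFDerivAt
  have dden : HasDerivAt (fun x : ℝ => 1 + x ^ 2) (2 * k ζ) (k ζ) := by
    simpa using (hasDerivAt_pow 2 (k ζ)).const_add 1
  have da : HasFDerivAt (fun z => -1 / (1 + k z ^ 2))
      ((2 * k ζ / (1 + k ζ ^ 2) ^ 2) • fderiv ℝ k ζ) ζ := by
    have h := (hasDerivAt_const (k ζ) (-1 : ℝ)).fun_div dden h1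
    refine (h.comp_hasFDerivAt ζ dk).congr_fderiv ?_
    congr 1; ring
  have db : HasFDerivAt (fun z => k z / (1 + k z ^ 2))
      (((1 - k ζ ^ 2) / (1 + k ζ ^ 2) ^ 2) • fderiv ℝ k ζ) ζ := by
    have h := (hasDerivAt_id (k ζ)).fun_div dden h1
    refine (h.comp_hasFDerivAt ζ dk).congr_fderiv ?_
    congr 1; simp only [id]; ring
  have ds : HasFDerivAt (fun z => Real.exp (-(L z / 2)))
      ((-(Real.exp (-(L ζ / 2)) / 2)) • fderiv ℝ L ζ) ζ := by
    have := ((dL.mul_const (1 / 2)).neg).exp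
    refine (HasFDerivAt.congr_of_eventuallyEq this ?_).congr_fderiv ?_
    · exact Eventually.of_forall fun z => by simp; ring_nf
    · ext; simp; ring_nf
  rw [flat_iff, bilinear_symm_iff, ← sub_eq_zero (a := fderiv ℝ (euclideanForm n L) ζ 1 Complex.I)]
  rw [sphereForm, euclideanForm, commutator_gaussForm (hn.differentiableAt (by simp)) hsq,
    curl_gaussForm hn2 da.differentiableAt db.differentiableAt
      ((contDiffAt_sphereForm hn hk).differentiableAt (by simp)),
    curl_gaussForm hn2 (differentiableAt_const _) ds.differentiableAt
      ((contDiffAt_euclideanForm hn hL).differentiableAt (by simp)),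
    da.fderiv, db.fderiv, ds.fderiv]
  -- Here `-(a² + b²) = a`, so the commutator terms on both sides of the flatness equation coincide
  -- and drop out.
  have hab : -((-1 / (1 + k ζ ^ 2)) ^ 2 + (k ζ / (1 + k ζ ^ 2)) ^ 2) = -1 / (1 + k ζ ^ 2) := by
    field_simp
  rw [hab, add_eq_right]
  obtain ⟨r1, r2⟩ := hrel
  set E := Real.exp (-(L ζ / 2)) with hE
  have hE0 : E ≠ 0 := (Real.exp_pos _).ne'
  simp only [smul_apply, smul_eq_mul, fderiv_fun_const, Pi.zero_apply, zero_apply, zero_sub,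
    add_zero, zero_smul]
  set X := n ζ * fderiv ℝ n ζ 1
  set Y := n ζ * fderiv ℝ n ζ Complex.I
  set W := tension n ζ
  generalize fderiv ℝ L ζ 1 = Lx at *
  generalize fderiv ℝ L ζ Complex.I = Ly at *
  generalize fderiv ℝ k ζ 1 = kx at *
  generalize fderiv ℝ k ζ Complex.I = ky at *
  generalize k ζ = k at *
  have hLx : Lx = -2 * (kx * (1 - k ^ 2) + 2 * k * ky) / (k * (1 + k ^ 2)) := by
    rw [← r1]; field_simp
  have hLy : Ly = 2 * (2 * k * kx - ky * (1 - k ^ 2)) / (k * (1 + k ^ 2)) := by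
    rw [← r2]; field_simp
  -- The factor is forced by the tension terms: it takes `b = k/(1+k²)` to `E`. The relation between
  -- the curvatures is what makes the other two coefficients match.
  have key : -(-(E / 2) * Ly) • Y - (-(E / 2) * Lx) • X - E • W =
      (E * (1 + k ^ 2) / k) • ((2 * k / (1 + k ^ 2) ^ 2 * kx -
        (1 - k ^ 2) / (1 + k ^ 2) ^ 2 * ky) • Y - ((1 - k ^ 2) / (1 + k ^ 2) ^ 2 * kx +
          2 * k / (1 + k ^ 2) ^ 2 * ky) • X - (k / (1 + k ^ 2)) • W) := by
    rw [hLx, hLy, smul_sub, smul_sub, smul_smul, smul_smul, smul_smul]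
    congr 1
    · congr 1
      · congr 1; field_simp
      · congr 1; field_simp
    · congr 1; field_simp
  rw [key, smul_eq_zero_iff_right (by positivity)]

end Integrability

/-! ### Geometry of the forms attached to a unit normal -/

section UnitNormal

theorem inner_eq_zero_of_anticommute {n x : ℍ[ℝ]} (hn : n.re = 0) (h : x * n = -(n * x)) :
    inner ℝ n x = 0 := by
  have := congr_arg (fun q : ℍ[ℝ] => q.re) h
  simp [hn] at this
  rw [inner_quat, hn]
  linarith

theorem re_mul_eq_zero_of_anticommute {n x : ℍ[ℝ]} (h : x * n = -(n * x)) : (n * x).re = 0 := by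
  have := congr_arg (fun q : ℍ[ℝ] => q.re) h
  simp at this
  simp
  linarith

theorem anticommute_of_inner_eq_zero {n x : ℍ[ℝ]} (hn : n.re = 0) (hx : x.re = 0)
    (h : inner ℝ n x = 0) : x * n = -(n * x) := by
  rw [inner_quat, hn] at h
  ext
  · simp [hn, hx] at *; linarith
  all_goals (simp [hn, hx]; try ring)

theorem vol3_combination (a b : ℝ) (x y n : E3) :
    vol3 (a • x + b • y) (a • y - b • x) n = (a ^ 2 + b ^ 2) * vol3 x y n := by
  simp only [vol3_eq, PiLp.add_apply, PiLp.sub_apply, PiLp.smul_apply, smul_eq_mul]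
  ring

theorem injective_of_vol3_pos {n : E3} {T : ℂ →L[ℝ] E3} (h : 0 < vol3 (T 1) (T Complex.I) n) :
    Function.Injective T := by
  rw [injective_iff_map_eq_zero]
  intro v hv
  rw [map_complex_eq] at hv
  have h0 := congr_arg (fun v : E3 => v 0) hv
  have h1 := congr_arg (fun v : E3 => v 1) hv
  have h2 := congr_arg (fun v : E3 => v 2) hv
  simp at h0 h1 h2
  have hA := h.ne'
  apply Complex.ext
  · apply mul_left_cancel₀ hA
    rw [vol3_eq, Complex.zero_re, mul_zero]
    linear_combination (T Complex.I 1 * n 2 - T Complex.I 2 * n 1) * h0 -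
      (T Complex.I 0 * n 2 - T Complex.I 2 * n 0) * h1 +
      (T Complex.I 0 * n 1 - T Complex.I 1 * n 0) * h2
  · apply mul_left_cancel₀ hA
    rw [vol3_eq, Complex.zero_im, mul_zero]
    linear_combination -(T 1 1 * n 2 - T 1 2 * n 1) * h0 +
      (T 1 0 * n 2 - T 1 2 * n 0) * h1 - (T 1 0 * n 1 - T 1 1 * n 0) * h2

theorem inner_fderiv_eq_zero {V : Type*} [NormedAddCommGroup V] [InnerProductSpace ℝ V]
    {f : ℂ → V} {ζ : ℂ} (hf : DifferentiableAt ℝ f ζ) (hu : ∀ z, ‖f z‖ = 1) (v : ℂ) :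
    inner ℝ (f ζ) (fderiv ℝ f ζ v) = 0 := by
  have h1 := HasFDerivAt.inner ℝ hf.hasFDerivAt hf.hasFDerivAt
  have h2 : (fun z => inner ℝ (f z) (f z)) = fun _ : ℂ => (1 : ℝ) := by
    funext z
    rw [real_inner_self_eq_norm_sq, hu, one_pow]
  rw [h2] at h1
  have h3 := congr_arg (fun A : ℂ →L[ℝ] ℝ => A v) (h1.unique (hasFDerivAt_const 1 ζ))
  simp [real_inner_comm (f ζ) (fderiv ℝ f ζ v)] at h3
  linarith

variable {N : ℂ → E3} {ζ : ℂ}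

theorem fderiv_toQuat_comp (hN : DifferentiableAt ℝ N ζ) :
    fderiv ℝ (fun z => toQuat (N z)) ζ = toQuat.comp (fderiv ℝ N ζ) :=
  (toQuat.hasFDerivAt.comp ζ hN.hasFDerivAt).fderiv

theorem contDiffAt_toQuat_comp (hN : ContDiffAt ℝ ∞ N ζ) :
    ContDiffAt ℝ ∞ (fun z => toQuat (N z)) ζ :=
  toQuat.contDiff.contDiffAt.comp ζ hN

theorem eventually_toQuat_mul_self (hu : ∀ z, ‖N z‖ = 1) :
    ∀ᶠ z in 𝓝 ζ, toQuat (N z) * toQuat (N z) = -1 :=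
  Eventually.of_forall fun z => toQuat_mul_self (hu z)

theorem toQuat_fderiv_anticommute (hN : DifferentiableAt ℝ N ζ) (hu : ∀ z, ‖N z‖ = 1) (v : ℂ) :
    toQuat (fderiv ℝ N ζ v) * toQuat (N ζ) = -(toQuat (N ζ) * toQuat (fderiv ℝ N ζ v)) := by
  have := fderiv_mul_eq_neg (n := fun z => toQuat (N z)) (ζ := ζ)
    (toQuat.hasFDerivAt.comp ζ hN.hasFDerivAt).differentiableAt (eventually_toQuat_mul_self hu) v
  rwa [fderiv_toQuat_comp hN] at this

variable {a b : ℂ → ℝ}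

theorem gaussForm_toQuat (hN : DifferentiableAt ℝ N ζ) (v : ℂ) :
    gaussForm (fun z => toQuat (N z)) a b ζ v =
      a ζ • (toQuat (N ζ) * toQuat (fderiv ℝ N ζ v)) +
        b ζ • (toQuat (N ζ) * toQuat (fderiv ℝ N ζ (Complex.I * v))) := by
  rw [gaussForm_apply, fderiv_toQuat_comp hN]
  rfl

theorem gaussForm_re (hN : DifferentiableAt ℝ N ζ) (hu : ∀ z, ‖N z‖ = 1) (v : ℂ) :
    (gaussForm (fun z => toQuat (N z)) a b ζ v).re = 0 := by
  rw [gaussForm_toQuat hN, Quaternion.re_add, Quaternion.re_smul, Quaternion.re_smul,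
    re_mul_eq_zero_of_anticommute (toQuat_fderiv_anticommute hN hu _),
    re_mul_eq_zero_of_anticommute (toQuat_fderiv_anticommute hN hu _)]
  simp

theorem mul_gaussForm (hN : DifferentiableAt ℝ N ζ) (hu : ∀ z, ‖N z‖ = 1) (v : ℂ) :
    toQuat (N ζ) * gaussForm (fun z => toQuat (N z)) a b ζ v =
      -(a ζ • toQuat (fderiv ℝ N ζ v) + b ζ • toQuat (fderiv ℝ N ζ (Complex.I * v))) := by
  rw [gaussForm_toQuat hN, mul_add, mul_smul_comm, mul_smul_comm, ← mul_assoc, ← mul_assoc,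
    toQuat_mul_self (hu ζ)]
  simp only [neg_mul, one_mul]
  module

theorem gaussForm_anticommute (hN : DifferentiableAt ℝ N ζ) (hu : ∀ z, ‖N z‖ = 1) (v : ℂ) :
    gaussForm (fun z => toQuat (N z)) a b ζ v * toQuat (N ζ) =
      -(toQuat (N ζ) * gaussForm (fun z => toQuat (N z)) a b ζ v) := by
  rw [mul_gaussForm hN hu, gaussForm_toQuat hN, add_mul, smul_mul_assoc, smul_mul_assoc,
    mul_assoc, mul_assoc, toQuat_fderiv_anticommute hN hu, toQuat_fderiv_anticommute hN hu,
    mul_neg, mul_neg, ← mul_assoc, ← mul_assoc, toQuat_mul_self (hu ζ)]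
  simp

theorem toQuat_ofQuat_gaussForm (hN : DifferentiableAt ℝ N ζ) (hu : ∀ z, ‖N z‖ = 1) (v : ℂ) :
    toQuat (ofQuat (gaussForm (fun z => toQuat (N z)) a b ζ v)) =
      gaussForm (fun z => toQuat (N z)) a b ζ v :=
  toQuat_ofQuat (gaussForm_re hN hu v)

theorem inner_ofQuat_gaussForm (hN : DifferentiableAt ℝ N ζ) (hu : ∀ z, ‖N z‖ = 1) (v : ℂ) :
    inner ℝ (N ζ) (ofQuat (gaussForm (fun z => toQuat (N z)) a b ζ v)) = 0 := by
  rw [← inner_toQuat, toQuat_ofQuat_gaussForm hN hu]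
  exact inner_eq_zero_of_anticommute rfl (gaussForm_anticommute hN hu v)

/-- The coefficients enter only through the factor `a² + b²`, so the orientation sign depends on the
Gauss map alone. This carries the orientation from one ambient space to the other. -/
theorem vol3_gaussForm (hN : DifferentiableAt ℝ N ζ) :
    vol3 (ofQuat (gaussForm (fun z => toQuat (N z)) a b ζ 1))
        (ofQuat (gaussForm (fun z => toQuat (N z)) a b ζ Complex.I)) (N ζ) =
      (a ζ ^ 2 + b ζ ^ 2) * vol3 (ofQuat (toQuat (N ζ) * toQuat (fderiv ℝ N ζ 1)))
        (ofQuat (toQuat (N ζ) * toQuat (fderiv ℝ N ζ Complex.I))) (N ζ) := by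
  rw [← vol3_combination, gaussForm_toQuat hN, gaussForm_toQuat hN, Complex.I_mul_I]
  simp [sub_eq_add_neg]

variable {k L : ℂ → ℝ}

/-- The left side is `q⁻¹ d(q n)` for a surface `q` with `q⁻¹ dq` equal to the form, so this is the
Weingarten equation in the left invariant frame. -/
theorem weingarten_sphereForm (hN : DifferentiableAt ℝ N ζ) (hu : ∀ z, ‖N z‖ = 1) (v : ℂ) :
    sphereForm (fun z => toQuat (N z)) k ζ v * toQuat (N ζ) + toQuat (fderiv ℝ N ζ v) =
      k ζ • (toQuat (N ζ) * sphereForm (fun z => toQuat (N z)) k ζ (Complex.I * v)) := by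
  have h1 : 1 + k ζ ^ 2 ≠ 0 := by positivity
  rw [sphereForm, gaussForm_anticommute hN hu, mul_gaussForm hN hu, mul_gaussForm hN hu,
    ← mul_assoc, Complex.I_mul_I, neg_one_mul, map_neg, map_neg]
  have e : k ζ * (k ζ / (1 + k ζ ^ 2)) = 1 - 1 / (1 + k ζ ^ 2) := by field_simp; ring
  simp only [smul_neg, smul_add, smul_smul, e]
  module

theorem weingarten_euclideanForm (hN : DifferentiableAt ℝ N ζ) (hu : ∀ z, ‖N z‖ = 1) (v : ℂ) :
    toQuat (fderiv ℝ N ζ v) = Real.exp (L ζ / 2) •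
      (toQuat (N ζ) * euclideanForm (fun z => toQuat (N z)) L ζ (Complex.I * v)) := by
  rw [euclideanForm, mul_gaussForm hN hu, ← mul_assoc, Complex.I_mul_I, neg_one_mul, map_neg,
    map_neg, zero_smul, zero_add, smul_neg, smul_neg, smul_neg, neg_neg, smul_smul,
    ← Real.exp_add]
  simp

/-- The Weingarten equation in the sphere determines the differential of the surface. -/
theorem eq_sphereForm (hN : DifferentiableAt ℝ N ζ) (hu : ∀ z, ‖N z‖ = 1) {τ : ℂ →L[ℝ] ℍ[ℝ]}
    (h : ∀ v, toQuat (fderiv ℝ N ζ v) =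
      toQuat (N ζ) * τ v + k ζ • (toQuat (N ζ) * τ (Complex.I * v))) :
    τ = sphereForm (fun z => toQuat (N z)) k ζ := by
  refine ContinuousLinearMap.ext fun v => ?_
  have h1 : 1 + k ζ ^ 2 ≠ 0 := by positivity
  have hs := toQuat_mul_self (hu ζ)
  rw [sphereForm, gaussForm_toQuat hN, h, h, ← mul_assoc Complex.I, Complex.I_mul_I, neg_one_mul,
    map_neg]
  simp only [mul_add, mul_smul_comm, mul_neg, ← mul_assoc, hs]
  have e : (1 : ℝ) = 1 / (1 + k ζ ^ 2) + k ζ / (1 + k ζ ^ 2) * k ζ := by field_simp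
  simp only [neg_mul, one_mul]
  have : τ v = (1 / (1 + k ζ ^ 2) + k ζ / (1 + k ζ ^ 2) * k ζ) • τ v := by rw [← e, one_smul]
  refine this.trans ?_
  module

/-- The Weingarten equation in Euclidean space determines the differential of the surface. -/
theorem eq_euclideanForm (hN : DifferentiableAt ℝ N ζ) (hu : ∀ z, ‖N z‖ = 1) {τ : ℂ →L[ℝ] ℍ[ℝ]}
    (h : ∀ v, toQuat (fderiv ℝ N ζ v) =
      Real.exp (L ζ / 2) • (toQuat (N ζ) * τ (Complex.I * v))) :
    τ = euclideanForm (fun z => toQuat (N z)) L ζ := by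
  refine ContinuousLinearMap.ext fun v => ?_
  have hs := toQuat_mul_self (hu ζ)
  rw [euclideanForm, gaussForm_toQuat hN, h (Complex.I * v), ← mul_assoc Complex.I,
    Complex.I_mul_I, neg_one_mul, map_neg, zero_smul, zero_add, mul_smul_comm, ← mul_assoc,
    smul_smul, ← Real.exp_add, mul_neg]
  simp [hs]

end UnitNormal

/-! ### Smoothness in charts and of integrated maps -/

section Smoothness

variable {X : Type*} [TopologicalSpace X] [ChartedSpace ℂ X] [IsManifold 𝓘(ℂ) ω X]
  {V : Type*} [NormedAddCommGroup V] [NormedSpace ℝ V]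

theorem contDiffAt_coord {f : X → V} (hf : ContMDiff 𝓘(ℝ, ℂ) 𝓘(ℝ, V) ∞ f)
    {e : OpenPartialHomeomorph X ℂ} (he : e ∈ atlas ℂ X) {ζ : ℂ} (hζ : ζ ∈ e.target) :
    ContDiffAt ℝ ∞ (f ∘ e.symm) ζ := by
  set p := e.symm ζ with hp
  have hps : p ∈ e.source := e.map_target hζ
  have hep : e p = ζ := e.right_inv hζ
  have h1 := (contMDiffAt_iff.1 (hf p)).2
  simp only [extChartAt, mfld_simps, contDiffWithinAt_univ] at h1
  rw [chartAt_self_eq] at h1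
  have hτ : ContDiffAt ℝ ∞ (chartAt ℂ p ∘ e.symm) (e p) :=
    ((contDiffAt_transition he (chart_mem_atlas ℂ p) hps
      (mem_chart_source ℂ p)).restrict_scalars ℝ).of_le (by simp)
  rw [← hep]
  refine ContDiffAt.congr_of_eventuallyEq ?_ (comp_symm_eventuallyEq f hps (mem_chart_source ℂ p))
  refine ContDiffAt.comp _ ?_ hτ
  simpa [e.left_inv hps] using h1

omit [IsManifold 𝓘(ℂ) ω X] in
theorem contMDiff_of_coord {f : X → V}
    (hf : ∀ e ∈ atlas ℂ X, ∀ ζ ∈ e.target, ContDiffAt ℝ ∞ (f ∘ e.symm) ζ) :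
    ContMDiff 𝓘(ℝ, ℂ) 𝓘(ℝ, V) ∞ f := by
  intro p
  have h := hf _ (chart_mem_atlas ℂ p) _ (mem_chart_target ℂ p)
  refine contMDiffAt_iff.2 ⟨?_, ?_⟩
  · have h2 : ContinuousAt ((f ∘ (chartAt ℂ p).symm) ∘ chartAt ℂ p) p :=
      ContinuousAt.comp h.continuousAt ((chartAt ℂ p).continuousAt (mem_chart_source ℂ p))
    refine h2.congr ?_
    filter_upwards [(chartAt ℂ p).open_source.mem_nhds (mem_chart_source ℂ p)] with x hx
    simp [(chartAt ℂ p).left_inv hx]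
  · simp only [extChartAt, mfld_simps, contDiffWithinAt_univ]
    rw [chartAt_self_eq]
    exact h

/-- Bootstrapping: the derivative `F θ` is as regular as `F`, so `F` gains one order at each step.
-/
theorem contDiffAt_of_parallel {𝔸 : Type*} [NormedRing 𝔸] [NormedAlgebra ℝ 𝔸] {s : Set ℂ}
    (hs : IsOpen s) {F : ℂ → 𝔸} {θ : ℂ → ℂ →L[ℝ] 𝔸} (hθ : ∀ z ∈ s, ContDiffAt ℝ ∞ θ z)
    (hF : ∀ z ∈ s, HasFDerivAt F (F z • θ z) z) {ζ : ℂ} (hζ : ζ ∈ s) : ContDiffAt ℝ ∞ F ζ := by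
  have h : ∀ n : ℕ, ContDiffOn ℝ n F s := by
    intro n
    induction n with
    | zero =>
      exact contDiffOn_zero.2 fun z hz => (hF z hz).continuousAt.continuousWithinAt
    | succ n ih =>
      push_cast
      rw [contDiffOn_succ_iff_fderiv_of_isOpen hs]
      refine ⟨fun z hz => (hF z hz).differentiableAt.differentiableWithinAt, by simp, ?_⟩
      have h1 : ContDiffOn ℝ n (fun z => (ContinuousLinearMap.mul ℝ 𝔸 (F z)).comp (θ z)) s := by
        intro z hz
        have h2 : ContDiffWithinAt ℝ n (fun z => ContinuousLinearMap.mul ℝ 𝔸 (F z)) s z :=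
          (ContinuousLinearMap.mul ℝ 𝔸).contDiff.contDiffAt.comp_contDiffWithinAt z (ih z hz)
        exact h2.clm_comp ((hθ z hz).of_le (WithTop.coe_le_coe.2 le_top)).contDiffWithinAt
      exact h1.congr fun z hz => (hF z hz).fderiv
  exact (contDiffOn_infty.2 h).contDiffAt (hs.mem_nhds hζ)

theorem contDiffAt_of_primitive {s : Set ℂ} (hs : IsOpen s) {F : ℂ → V} {θ : ℂ → ℂ →L[ℝ] V}
    (hθ : ∀ z ∈ s, ContDiffAt ℝ ∞ θ z) (hF : ∀ z ∈ s, HasFDerivAt F (θ z) z) {ζ : ℂ}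
    (hζ : ζ ∈ s) : ContDiffAt ℝ ∞ F ζ := by
  have h : ContDiffOn ℝ ∞ F s := by
    rw [contDiffOn_infty_iff_fderiv_of_isOpen hs]
    refine ⟨fun z hz => (hF z hz).differentiableAt.differentiableWithinAt, ?_⟩
    exact ContDiffOn.congr (fun z hz => (hθ z hz).contDiffWithinAt) fun z hz => (hF z hz).fderiv
  exact h.contDiffAt (hs.mem_nhds hζ)

end Smoothness

/-! ### Primitives of closed forms -/

section Primitives

variable {X : Type*} [TopologicalSpace X] [ChartedSpace ℂ X] [IsManifold 𝓘(ℂ) ω X]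
  [SimplyConnectedSpace X]

/-- On a simply connected surface, a closed one-form is exact. -/
theorem exists_primitive {θ : OpenPartialHomeomorph X ℂ → ℂ → ℂ →L[ℝ] ℝ} (hθ : IsOneForm θ)
    (hsm : ∀ e ∈ atlas ℂ X, ∀ ζ ∈ e.target, ContDiffAt ℝ 2 (θ e) ζ)
    (hcl : ∀ e ∈ atlas ℂ X, ∀ ζ ∈ e.target, ∀ u v,
      fderiv ℝ (θ e) ζ u v = fderiv ℝ (θ e) ζ v u) :
    ∃ f : X → ℝ, ∀ e ∈ atlas ℂ X, ∀ ζ ∈ e.target, HasFDerivAt (f ∘ e.symm) (θ e ζ) ζ := by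
  obtain ⟨F, -, hF0, hF⟩ := exists_global_parallel hθ hsm
    (fun e he ζ hζ u v => by rw [hcl e he ζ hζ u v, mul_comm])
  -- Over the commutative field `ℝ` closedness is flatness, and a nowhere zero solution of `dF = F
  -- θ` satisfies `d log |F| = θ`.
  refine ⟨fun p => Real.log (F p), fun e he ζ hζ => ?_⟩
  refine ((hF e he ζ hζ).log (hF0 _)).congr_fderiv ?_
  ext
  simp [hF0]

theorem exists_primitive_E3 {θ : OpenPartialHomeomorph X ℂ → ℂ → ℂ →L[ℝ] E3} (hθ : IsOneForm θ)
    (hsm : ∀ e ∈ atlas ℂ X, ∀ ζ ∈ e.target, ContDiffAt ℝ ∞ (θ e) ζ)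
    (hcl : ∀ e ∈ atlas ℂ X, ∀ ζ ∈ e.target, ∀ u v,
      fderiv ℝ (θ e) ζ u v = fderiv ℝ (θ e) ζ v u) :
    ∃ f : X → E3, ∀ e ∈ atlas ℂ X, ∀ ζ ∈ e.target, HasFDerivAt (f ∘ e.symm) (θ e ζ) ζ := by
  have h : ∀ i : Fin 3, ∃ f : X → ℝ, ∀ e ∈ atlas ℂ X, ∀ ζ ∈ e.target,
      HasFDerivAt (f ∘ e.symm) ((EuclideanSpace.proj i : E3 →L[ℝ] ℝ).comp (θ e ζ)) ζ := by
    intro i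
    have hd : ∀ e ∈ atlas ℂ X, ∀ ζ ∈ e.target,
        HasFDerivAt (fun z => (EuclideanSpace.proj i : E3 →L[ℝ] ℝ).comp (θ e z))
          ((ContinuousLinearMap.compL ℝ ℂ E3 ℝ (EuclideanSpace.proj i)).comp
            (fderiv ℝ (θ e) ζ)) ζ :=
      fun e he ζ hζ => (ContinuousLinearMap.compL ℝ ℂ E3 ℝ
        (EuclideanSpace.proj i)).hasFDerivAt.comp ζ
          ((hsm e he ζ hζ).differentiableAt (by simp)).hasFDerivAt
    refine exists_primitive
      (θ := fun e z => (EuclideanSpace.proj i : E3 →L[ℝ] ℝ).comp (θ e z)) ?_ ?_ ?_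
    · intro e he e' he' p hp hp'
      change (EuclideanSpace.proj i : E3 →L[ℝ] ℝ).comp (θ e (e p)) = _
      rw [hθ e he e' he' p hp hp']
      rfl
    · intro e he ζ hζ
      exact ContDiffAt.clm_comp contDiffAt_const
        ((hsm e he ζ hζ).of_le (WithTop.coe_le_coe.2 le_top))
    · intro e he ζ hζ u v
      rw [(hd e he ζ hζ).fderiv]
      simp [hcl e he ζ hζ u v]
  choose f hf using h
  refine ⟨fun p => WithLp.toLp 2 fun i => f i p, fun e he ζ hζ => ?_⟩
  rw [← hasFDerivWithinAt_univ, hasFDerivWithinAt_euclidean]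
  exact fun i => (hf i e he ζ hζ).hasFDerivWithinAt

end Primitives

/-! ### Necessity of the integrability conditions -/

section Flatness

variable {V : Type*} [NormedAddCommGroup V] [NormedSpace ℝ V]

theorem closed_of_primitive {F : ℂ → V} {θ : ℂ → ℂ →L[ℝ] V} {ζ : ℂ}
    (hθ : DifferentiableAt ℝ θ ζ) (hF : ∀ᶠ z in 𝓝 ζ, HasFDerivAt F (θ z) z) (u v : ℂ) :
    fderiv ℝ θ ζ u v = fderiv ℝ θ ζ v u :=
  second_derivative_symmetric_of_eventually_of_real hF hθ.hasFDerivAt u v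

/-- The second derivative of `F` is `F (θ u θ v + Dθ u v)`; it is symmetric, and `F` can be
cancelled. -/
theorem flat_of_parallel {𝔸 : Type*} [NormedDivisionRing 𝔸] [NormedAlgebra ℝ 𝔸] {F : ℂ → 𝔸}
    {θ : ℂ → ℂ →L[ℝ] 𝔸} {ζ : ℂ} (hθ : DifferentiableAt ℝ θ ζ)
    (hF : ∀ᶠ z in 𝓝 ζ, HasFDerivAt F (F z • θ z) z) (h0 : F ζ ≠ 0) (u v : ℂ) :
    fderiv ℝ θ ζ u v + θ ζ u * θ ζ v = fderiv ℝ θ ζ v u + θ ζ v * θ ζ u := by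
  have h1 : HasFDerivAt (fun z => ContinuousLinearMap.mul ℝ 𝔸 (F z))
      ((ContinuousLinearMap.mul ℝ 𝔸).comp (F ζ • θ ζ)) ζ :=
    (ContinuousLinearMap.mul ℝ 𝔸).hasFDerivAt.comp ζ hF.self_of_nhds
  have h2 := second_derivative_symmetric_of_eventually_of_real (f := F)
    (f' := fun z => (ContinuousLinearMap.mul ℝ 𝔸 (F z)).comp (θ z)) hF
    (h1.clm_comp hθ.hasFDerivAt) u v
  simp at h2
  rw [mul_assoc, mul_assoc, ← mul_add, ← mul_add] at h2
  exact mul_left_cancel₀ h0 h2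

theorem contDiffAt_vol3 {a b c : ℂ → E3} {ζ : ℂ} (ha : ContDiffAt ℝ ∞ a ζ)
    (hb : ContDiffAt ℝ ∞ b ζ) (hc : ContDiffAt ℝ ∞ c ζ) :
    ContDiffAt ℝ ∞ (fun z => vol3 (a z) (b z) (c z)) ζ := by
  rw [contDiffAt_euclidean] at ha hb hc
  simp only [vol3_eq]
  have a0 := ha 0
  have a1 := ha 1
  have a2 := ha 2
  have b0 := hb 0
  have b1 := hb 1
  have b2 := hb 2
  have c0 := hc 0
  have c1 := hc 1
  have c2 := hc 2
  fun_prop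

end Flatness

/-! ### Invariance under coordinate change and the Euclidean structure equation -/

section Forms

variable {X : Type*} [TopologicalSpace X] [ChartedSpace ℂ X] [IsManifold 𝓘(ℂ) ω X]

/-- Coordinate independence holds because changes of complex charts commute with multiplication by
`i`, so `dn ∘ i` is as intrinsic as `dn`. -/
theorem isOneForm_gaussForm {n : X → ℍ[ℝ]}
    (hn : ∀ e ∈ atlas ℂ X, ∀ ζ ∈ e.target, DifferentiableAt ℝ (n ∘ e.symm) ζ) (a b : X → ℝ) :
    IsOneForm (X := X) fun e =>
      gaussForm (fun z => n (e.symm z)) (fun z => a (e.symm z)) (fun z => b (e.symm z)) := by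
  intro e he e' he' p hp hp'
  have h1 : fderiv ℝ (fun z => n (e.symm z)) (e p) =
      (fderiv ℝ (fun z => n (e'.symm z)) (e' p)).comp (fderiv ℝ (e' ∘ e.symm) (e p)) :=
    (hasFDerivAt_change_chart he he' hp hp'
      (hn e' he' _ (e'.map_source hp')).hasFDerivAt).fderiv
  refine ContinuousLinearMap.ext fun v => ?_
  simp only [ContinuousLinearMap.comp_apply, gaussForm_apply, e.left_inv hp, e'.left_inv hp', h1,
    fderiv_transition_mul_I he he' hp hp']

omit [IsManifold 𝓘(ℂ) ω X] in
theorem IsOneForm.comp {V W : Type*} [NormedAddCommGroup V] [NormedSpace ℝ V]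
    [NormedAddCommGroup W] [NormedSpace ℝ W]
    {θ : OpenPartialHomeomorph X ℂ → ℂ → ℂ →L[ℝ] V} (hθ : IsOneForm θ) (L : V →L[ℝ] W) :
    IsOneForm fun e z => L.comp (θ e z) := by
  intro e he e' he' p hp hp'
  change L.comp (θ e (e p)) = _
  rw [hθ e he e' he' p hp hp']
  rfl

variable {ψ N : X → E3} {K : X → ℝ}

omit [IsManifold 𝓘(ℂ) ω X] in
theorem exp_half_log {x : ℝ} (hx : 0 < x) : Real.exp (Real.log x / 2) = √x := by
  rw [Real.sqrt_eq_rpow, Real.rpow_def_of_pos hx]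
  ring_nf

/-- The structure equation of a surface in Euclidean space in terms of its Gauss map. -/
theorem IsSurfaceR3.structure_equation (h : IsSurfaceR3 ψ N K) {e : OpenPartialHomeomorph X ℂ}
    (he : e ∈ atlas ℂ X) {ζ : ℂ} (hζ : ζ ∈ e.target) :
    ContDiffAt ℝ ∞ (fun z => K (e.symm z)) ζ ∧ 0 < K (e.symm ζ) ∧
      toQuat.comp (coordDeriv e ψ ζ) = euclideanForm (fun z => toQuat (N (e.symm z)))
        (fun z => Real.log (K (e.symm z))) ζ := by
  have hNs : ∀ z ∈ e.target, ContDiffAt ℝ ∞ (fun z => N (e.symm z)) z :=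
    fun z hz => contDiffAt_coord h.smooth_normal he hz
  have hψs : ContDiffAt ℝ ∞ (fun z => ψ (e.symm z)) ζ := contDiffAt_coord h.smooth he hζ
  have hNd : ∀ z ∈ e.target, DifferentiableAt ℝ (fun z => N (e.symm z)) z :=
    fun z hz => (hNs z hz).differentiableAt (by simp)
  have hu : ∀ z, ‖N (e.symm z)‖ = 1 := fun z => h.unit _
  have hw : ∀ z ∈ e.target, _ := fun z hz => weingarten_of_conformal (hu z)
    (h.normal e he z hz) (inner_fderiv_eq_zero (hNd z hz) hu) (h.conformal e he z hz)
    (h.oriented e he z hz) (h.curvature e he z hz)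
  refine ⟨?_, (hw ζ hζ).1, eq_euclideanForm (hNd ζ hζ) hu fun v => ?_⟩
  · have hdN : ∀ w, ContDiffAt ℝ ∞ (fun z => coordDeriv e N z w) ζ := fun w =>
      ((hNs ζ hζ).fderiv_right (m := ∞) (by simp)).clm_apply contDiffAt_const
    have hdψ : ∀ w, ContDiffAt ℝ ∞ (fun z => coordDeriv e ψ z w) ζ := fun w =>
      (hψs.fderiv_right (m := ∞) (by simp)).clm_apply contDiffAt_const
    -- No regularity of the curvature is assumed; it is smooth because it is the quotient of two
    -- smooth area elements.
    refine ContDiffAt.congr_of_eventuallyEq ((contDiffAt_vol3 (hdN 1) (hdN Complex.I)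
      (hNs ζ hζ)).div (contDiffAt_vol3 (hdψ 1) (hdψ Complex.I) (hNs ζ hζ))
        (h.oriented e he ζ hζ).ne') ?_
    filter_upwards [e.open_target.mem_nhds hζ] with z hz using (hw z hz).2.1
  · rw [exp_half_log (hw ζ hζ).1]
    exact (hw ζ hζ).2.2 v

omit [TopologicalSpace X] [ChartedSpace ℂ X] [IsManifold 𝓘(ℂ) ω X] in
theorem curvatureFactor_eq {K : X → ℝ} (hK : ∀ p, 0 < K p) (p : X) :
    curvatureFactor K p = (Complex.I + (√(K p) : ℂ)) ^ 4 / ((√(K p) : ℂ) ^ 2) := by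
  rw [curvatureFactor]
  congr 1
  rw [← Complex.ofReal_pow, Real.sq_sqrt (hK p).le]

end Forms

/-! ### From Euclidean space to the sphere -/

section Sphere

variable {X : Type*} [TopologicalSpace X] [ChartedSpace ℂ X] [IsManifold 𝓘(ℂ) ω X]

omit [IsManifold 𝓘(ℂ) ω X] in
/-- A parallel frame of an imaginary connection form has constant norm. -/
theorem norm_eq_one_of_parallel [PreconnectedSpace X] {F : X → ℍ[ℝ]}
    {θ : OpenPartialHomeomorph X ℂ → ℂ → ℂ →L[ℝ] ℍ[ℝ]}
    (hF : ∀ e ∈ atlas ℂ X, ∀ ζ ∈ e.target, HasFDerivAt (F ∘ e.symm) (F (e.symm ζ) • θ e ζ) ζ)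
    (hre : ∀ e ∈ atlas ℂ X, ∀ ζ ∈ e.target, ∀ v, (θ e ζ v).re = 0) (h1 : ∃ p, F p = 1) (p : X) :
    ‖F p‖ = 1 := by
  have hlc : IsLocallyConstant (fun p => inner ℝ (F p) (F p)) := by
    rw [IsLocallyConstant.iff_eventually_eq]
    intro q
    set e := chartAt ℂ q
    have he : e ∈ atlas ℂ X := chart_mem_atlas ℂ q
    have hq : q ∈ e.source := mem_chart_source ℂ q
    obtain ⟨r, hr, hball⟩ := Metric.eventually_nhds_iff_ball.1
      (e.open_target.mem_nhds (e.map_source hq))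
    have hder : ∀ z ∈ ball (e q) r,
        HasFDerivAt (fun z => inner ℝ (F (e.symm z)) (F (e.symm z))) (0 : ℂ →L[ℝ] ℝ) z := by
      intro z hz
      have h2 := hF e he z (hball z hz)
      refine (HasFDerivAt.inner ℝ h2 h2).congr_fderiv ?_
      refine ContinuousLinearMap.ext fun v => ?_
      -- `⟨F, F θ⟩ = |F|² Re θ`, which vanishes for imaginary `θ`.
      have h3 : inner ℝ (F (e.symm z)) (F (e.symm z) * θ e z v) = 0 := by
        have := inner_mul_left_quat (F (e.symm z)) 1 (θ e z v)
        rw [mul_one] at this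
        rw [this, inner_quat]
        simp [hre e he z (hball z hz) v]
      simp [h3, real_inner_comm (F (e.symm z)) (F (e.symm z) * θ e z v)]
    filter_upwards [(e.continuousAt hq).eventually (ball_mem_nhds _ hr),
      e.open_source.mem_nhds hq] with y hy hys
    have := isOpen_ball.is_const_of_fderiv_eq_zero (𝕜 := ℝ) (convex_ball (e q) r).isPreconnected
      (fun y hy => (hder y hy).differentiableAt.differentiableWithinAt)
      (fun y hy => (hder y hy).fderiv) hy (mem_ball_self hr)
    rwa [e.left_inv hys, e.left_inv hq] at this
  obtain ⟨p₀, hp₀⟩ := h1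
  have h2 := hlc.apply_eq_of_preconnectedSpace p p₀
  rw [hp₀, real_inner_self_eq_norm_sq, real_inner_self_eq_norm_sq, norm_one] at h2
  nlinarith [norm_nonneg (F p)]

/-- Left multiplication, from the Lie algebra to the tangent space of the sphere at `q`. -/
def leftMul (q : ℍ[ℝ]) : E3 →L[ℝ] ℍ[ℝ] := (ContinuousLinearMap.mul ℝ ℍ[ℝ] q).comp toQuat

theorem leftMul_apply (q : ℍ[ℝ]) (v : E3) : leftMul q v = q * toQuat v := rfl

theorem inner_leftMul {q : ℍ[ℝ]} (hq : ‖q‖ = 1) (a b : E3) :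
    inner ℝ (leftMul q a) (leftMul q b) = inner ℝ a b := by
  rw [leftMul_apply, leftMul_apply, inner_mul_left_quat, hq, inner_toQuat]
  simp

theorem leftTranslate_leftMul {q : ℍ[ℝ]} (hq : ‖q‖ = 1) (v : E3) :
    leftTranslate q (leftMul q v) = v := by
  rw [leftTranslate_eq, leftMul_apply, inv_eq_star_of_norm_eq_one hq, ← mul_assoc,
    star_mul_self_of_norm_eq_one hq, one_mul, ofQuat_toQuat]

/-- Subtracting the component along `q` from `q x` is the same as deleting the real part of `x`.
Covariant differentiation in the sphere thus becomes taking the imaginary part after left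
translation. -/
theorem leftMul_ofQuat {q : ℍ[ℝ]} (hq : ‖q‖ = 1) (x : ℍ[ℝ]) :
    leftMul q (ofQuat x) = q * x - inner ℝ q (q * x) • q := by
  have h1 : inner ℝ q (q * x) = x.re := by
    have := inner_mul_left_quat q 1 x
    rw [mul_one, hq] at this
    rw [this, inner_quat]
    simp
  have h2 : toQuat (ofQuat x) = x - x.re • (1 : ℍ[ℝ]) := by
    ext <;> simp [ofQuat_apply]
  rw [leftMul_apply, h1, h2, mul_sub, mul_smul_comm, mul_one]

/-- The shape operator, in the left invariant frame, of the surface obtained by integrating the form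
determined by a Gauss map and an extrinsic curvature. -/
theorem exists_leftMul_factor {P : ℂ → ℍ[ℝ]} {N : ℂ → E3} {k : ℂ → ℝ} {ζ : ℂ} (hP : ‖P ζ‖ = 1)
    (hN : DifferentiableAt ℝ N ζ) (hu : ∀ z, ‖N z‖ = 1)
    (hd : HasFDerivAt P (P ζ • sphereForm (fun z => toQuat (N z)) k ζ) ζ) :
    ∃ T D : ℂ →L[ℝ] E3, fderiv ℝ P ζ = (leftMul (P ζ)).comp T ∧
      (∀ v, T v = ofQuat (sphereForm (fun z => toQuat (N z)) k ζ v)) ∧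
      sphereCov (P ζ) (fderiv ℝ (fun z => leftMul (P z) (N z)) ζ) = (leftMul (P ζ)).comp D ∧
      ∀ v, toQuat (D v) = k ζ • (toQuat (N ζ) * toQuat (T (Complex.I * v))) := by
  have hw := weingarten_sphereForm (k := k) hN hu
  have hre : ∀ v, (toQuat (N ζ) * sphereForm (fun z => toQuat (N z)) k ζ v).re = 0 :=
    fun v => re_mul_eq_zero_of_anticommute (gaussForm_anticommute hN hu v)
  have hτ : ∀ v, toQuat (ofQuat (sphereForm (fun z => toQuat (N z)) k ζ v)) =
      sphereForm (fun z => toQuat (N z)) k ζ v := fun v => toQuat_ofQuat_gaussForm hN hu v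
  generalize sphereForm (fun z => toQuat (N z)) k ζ = τ at hd hw hre hτ ⊢
  refine ⟨ofQuat.comp τ, k ζ • ofQuat.comp ((ContinuousLinearMap.mul ℝ ℍ[ℝ]
    (toQuat (N ζ))).comp (τ.comp mulI)), ?_, fun v => rfl, ?_, fun v => ?_⟩
  · rw [hd.fderiv]
    exact ContinuousLinearMap.ext fun v => congrArg (P ζ * ·) (hτ v).symm
  -- The product rule gives `d(P n) = P (τ n + dn)`, and `hw` rewrites the bracket.
  · have hd2 : ∀ v, fderiv ℝ (fun z => leftMul (P z) (N z)) ζ v =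
        P ζ * (k ζ • (toQuat (N ζ) * τ (Complex.I * v))) := by
      intro v
      have h1 := hd.mul' (toQuat.hasFDerivAt.comp ζ hN.hasFDerivAt)
      have h2 : fderiv ℝ (fun z => leftMul (P z) (N z)) ζ = _ := h1.fderiv
      rw [h2, ← hw v, mul_add]
      change P ζ * toQuat (fderiv ℝ N ζ v) + (P ζ * τ v) * toQuat (N ζ) = _
      rw [mul_assoc, add_comm]
    refine ContinuousLinearMap.ext fun v => ?_
    have h3 := leftMul_ofQuat hP (k ζ • (toQuat (N ζ) * τ (Complex.I * v)))
    rw [← hd2, map_smul] at h3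
    exact h3.symm
  · change toQuat (k ζ • ofQuat (toQuat (N ζ) * τ (Complex.I * v))) =
      k ζ • (toQuat (N ζ) * toQuat (ofQuat (τ (Complex.I * v))))
    rw [hτ, map_smul, toQuat_ofQuat (hre _)]

variable {ψ N : X → E3} {K : X → ℝ}

/-- The surface in the sphere obtained by integrating the form determined by a Gauss map and an
extrinsic curvature. -/
theorem isSurfaceS3_of_parallel {P : X → ℍ[ℝ]} (hP : ∀ p, ‖P p‖ = 1)
    (hN : ContMDiff 𝓘(ℝ, ℂ) 𝓘(ℝ, E3) ∞ N) (hu : ∀ p, ‖N p‖ = 1)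
    (hK : ContMDiff 𝓘(ℝ, ℂ) 𝓘(ℝ, ℝ) ∞ K) (hpos : ∀ p, 0 < K p)
    (hd : ∀ e ∈ atlas ℂ X, ∀ ζ ∈ e.target, HasFDerivAt (P ∘ e.symm) (P (e.symm ζ) •
      sphereForm (fun z => toQuat (N (e.symm z))) (fun z => √(K (e.symm z))) ζ) ζ)
    (hvol : ∀ e ∈ atlas ℂ X, ∀ ζ ∈ e.target,
      0 < vol3 (ofQuat (sphereForm (fun z => toQuat (N (e.symm z))) (fun z => √(K (e.symm z))) ζ 1))
        (ofQuat (sphereForm (fun z => toQuat (N (e.symm z))) (fun z => √(K (e.symm z))) ζ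
          Complex.I)) (N (e.symm ζ))) :
    IsSurfaceS3 (fun p => ⟨P p, mem_sphere_zero_iff_norm.2 (hP p)⟩) (fun p => leftMul (P p) (N p))
      K := by
  have hNs : ∀ e ∈ atlas ℂ X, ∀ z ∈ e.target, ContDiffAt ℝ ∞ (fun z => N (e.symm z)) z :=
    fun e he z hz => contDiffAt_coord hN he hz
  have hPs : ∀ e ∈ atlas ℂ X, ∀ z ∈ e.target, ContDiffAt ℝ ∞ (P ∘ e.symm) z :=
    fun e he z hz => contDiffAt_of_parallel e.open_target
      (fun z hz => contDiffAt_sphereForm (contDiffAt_toQuat_comp (hNs e he z hz))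
        ((contDiffAt_coord hK he hz).sqrt (hpos _).ne')) (fun z hz => hd e he z hz) hz
  have key : ∀ e ∈ atlas ℂ X, ∀ ζ ∈ e.target, ∃ T D : ℂ →L[ℝ] E3,
      coordDeriv e P ζ = (leftMul (P (e.symm ζ))).comp T ∧
      sphereCov (P (e.symm ζ)) (coordDeriv e (fun p => leftMul (P p) (N p)) ζ) =
        (leftMul (P (e.symm ζ))).comp D ∧
      (∀ v, inner ℝ (N (e.symm ζ)) (T v) = 0) ∧ 0 < vol3 (T 1) (T Complex.I) (N (e.symm ζ)) ∧
      ConformalSecondForm T D ∧ ShapeDet T D (K (e.symm ζ)) := by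
    intro e he ζ hζ
    have hNd : DifferentiableAt ℝ (fun z => N (e.symm z)) ζ :=
      (hNs e he ζ hζ).differentiableAt (by simp)
    obtain ⟨T, D, hT, hT', hD, hD'⟩ := exists_leftMul_factor (P := P ∘ e.symm) (hP _) hNd
      (fun z => hu _) (hd e he ζ hζ)
    have hvol' : 0 < vol3 (T 1) (T Complex.I) (N (e.symm ζ)) := by
      rw [hT', hT']
      exact hvol e he ζ hζ
    have hperp : ∀ v, inner ℝ (N (e.symm ζ)) (T v) = 0 := by
      intro v
      rw [hT']
      exact inner_ofQuat_gaussForm hNd (fun z => hu _) v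
    have := conformal_of_weingarten (hu (e.symm ζ)) hperp hvol' (Real.sqrt_pos.2 (hpos _)) hD'
    rw [Real.sq_sqrt (hpos _).le] at this
    exact ⟨T, D, hT, hD, hperp, hvol', this⟩
  refine ⟨contMDiff_of_coord hPs, contMDiff_of_coord fun e he ζ hζ => ?_, fun p => ?_, fun p => ?_,
    fun e he ζ hζ => ?_, fun e he ζ hζ v => ?_, fun e he ζ hζ => ?_,
    fun e he ζ hζ => ?_, fun e he ζ hζ => ?_⟩
  · exact (hPs e he ζ hζ).mul (contDiffAt_toQuat_comp (hNs e he ζ hζ))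
  · rw [← sq_eq_sq₀ (norm_nonneg _) zero_le_one, ← real_inner_self_eq_norm_sq,
      inner_leftMul (hP p), real_inner_self_eq_norm_sq, hu]
  · have := inner_mul_left_quat (P p) (toQuat (N p)) 1
    rw [mul_one] at this
    change inner ℝ (leftMul (P p) (N p)) (P p) = 0
    rw [leftMul_apply, this, inner_quat]
    simp
  all_goals
    obtain ⟨T, D, hT, hD, hperp, hvol', hc, hs⟩ := key e he ζ hζ
  · change Function.Injective (coordDeriv e P ζ)
    rw [hT]
    exact (Function.LeftInverse.injective (leftTranslate_leftMul (hP (e.symm ζ)))).comp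
      (injective_of_vol3_pos hvol')
  · change inner ℝ (leftMul _ _) (coordDeriv e P ζ v) = 0
    rw [hT]
    exact (inner_leftMul (hP _) _ _).trans (hperp v)
  · change ConformalSecondForm (coordDeriv e P ζ) (sphereCov (P (e.symm ζ)) _)
    rw [hT, hD]
    exact (conformalSecondForm_comp_iff _ (inner_leftMul (hP _)) _ _).2 hc
  · change 0 < vol3 (leftTranslate _ (coordDeriv e P ζ 1)) (leftTranslate _ (coordDeriv e P ζ _))
      (leftTranslate (P (e.symm ζ)) (leftMul (P (e.symm ζ)) _))
    rw [hT]
    change 0 < vol3 (leftTranslate (P (e.symm ζ)) (leftMul _ _))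
      (leftTranslate (P (e.symm ζ)) (leftMul _ _)) _
    rwa [leftTranslate_leftMul (hP _), leftTranslate_leftMul (hP _), leftTranslate_leftMul (hP _)]
  · change ShapeDet (coordDeriv e P ζ) (sphereCov (P (e.symm ζ)) _) _
    rw [hT, hD]
    exact (shapeDet_comp_iff _ (inner_leftMul (hP _)) _ _ _).2 hs

/-- A surface in Euclidean space and a compatible curvature function determine a surface in the
sphere with the same Gauss map. -/
theorem exists_surfaceS3 [SimplyConnectedSpace X] {Kstar : X → ℝ} (h : IsSurfaceR3 ψ N Kstar)
    (hK : ContMDiff 𝓘(ℝ, ℂ) 𝓘(ℝ, ℝ) ∞ K) (hpos : ∀ p, 0 < K p)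
    (hrel : CurvatureRelation K Kstar) :
    ∃ (φ : X → S3) (M : X → ℍ[ℝ]), IsSurfaceS3 φ M K ∧ gaussMapS3 φ M = gaussMapR3 N := by
  have hNs : ∀ e ∈ atlas ℂ X, ∀ z ∈ e.target, ContDiffAt ℝ ∞ (fun z => N (e.symm z)) z :=
    fun e he z hz => contDiffAt_coord h.smooth_normal he hz
  have hNd : ∀ e ∈ atlas ℂ X, ∀ z ∈ e.target, DifferentiableAt ℝ (fun z => N (e.symm z)) z :=
    fun e he z hz => (hNs e he z hz).differentiableAt (by simp)
  have hns : ∀ e ∈ atlas ℂ X, ∀ z ∈ e.target, ContDiffAt ℝ ∞ (fun z => toQuat (N (e.symm z))) z :=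
    fun e he z hz => contDiffAt_toQuat_comp (hNs e he z hz)
  have hks : ∀ e ∈ atlas ℂ X, ∀ z ∈ e.target, ContDiffAt ℝ ∞ (fun z => √(K (e.symm z))) z :=
    fun e he z hz => (contDiffAt_coord hK he hz).sqrt (hpos _).ne'
  have hLs : ∀ e ∈ atlas ℂ X, ∀ z ∈ e.target,
      ContDiffAt ℝ ∞ (fun z => Real.log (Kstar (e.symm z))) z :=
    fun e he z hz => (h.structure_equation he hz).1.log (h.structure_equation he hz).2.1.ne'
  have hclosed : ∀ e ∈ atlas ℂ X, ∀ ζ ∈ e.target, ∀ u v,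
      fderiv ℝ (euclideanForm (fun z => toQuat (N (e.symm z)))
        (fun z => Real.log (Kstar (e.symm z)))) ζ u v =
      fderiv ℝ (euclideanForm (fun z => toQuat (N (e.symm z)))
        (fun z => Real.log (Kstar (e.symm z)))) ζ v u := by
    intro e he ζ hζ
    refine closed_of_primitive (F := fun z => toQuat (ψ (e.symm z)))
      ((contDiffAt_euclideanForm (hns e he ζ hζ) (hLs e he ζ hζ)).differentiableAt (by simp)) ?_
    filter_upwards [e.open_target.mem_nhds hζ] with z hz
    rw [← (h.structure_equation he hz).2.2]
    exact toQuat.hasFDerivAt.comp z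
      ((contDiffAt_coord h.smooth he hz).differentiableAt (by simp)).hasFDerivAt
  have hreal : ∀ e ∈ atlas ℂ X, ∀ ζ ∈ e.target, RealRelation (fun z => √(K (e.symm z)))
      (fun z => Real.log (Kstar (e.symm z))) ζ := by
    intro e he ζ hζ
    rw [← realRelation_iff ((hks e he ζ hζ).differentiableAt (by simp))
      ((hLs e he ζ hζ).differentiableAt (by simp)) (Real.sqrt_pos.2 (hpos _))]
    have := hrel e he ζ hζ
    simp only [curvatureFactor_eq hpos] at this
    exact this
  obtain ⟨P, hP1, -, hP⟩ := exists_global_parallel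
    (θ := fun e => sphereForm (fun z => toQuat (N (e.symm z))) (fun z => √(K (e.symm z))))
    (isOneForm_gaussForm (n := fun p => toQuat (N p))
      (fun e he ζ hζ => (hns e he ζ hζ).differentiableAt (by simp))
      (fun p => -1 / (1 + √(K p) ^ 2)) (fun p => √(K p) / (1 + √(K p) ^ 2)))
    (fun e he ζ hζ => (contDiffAt_sphereForm (hns e he ζ hζ) (hks e he ζ hζ)).of_le
      (WithTop.coe_le_coe.2 le_top))
    -- The Euclidean form is closed because the given surface is its primitive; this transfers to
    -- flatness of the spherical form.
    (fun e he ζ hζ => (flat_sphereForm_iff (hns e he ζ hζ)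
      (eventually_toQuat_mul_self fun z => h.unit _) (hks e he ζ hζ) (hLs e he ζ hζ)
      (Real.sqrt_pos.2 (hpos _)) (hreal e he ζ hζ)).2 (hclosed e he ζ hζ))
  have hPn : ∀ p, ‖P p‖ = 1 := norm_eq_one_of_parallel hP
    (fun e he ζ hζ v => gaussForm_re (hNd e he ζ hζ) (fun z => h.unit _) v) hP1
  refine ⟨_, _, isSurfaceS3_of_parallel hPn h.smooth_normal h.unit hK hpos hP ?_, ?_⟩
  · intro e he ζ hζ
    have h1 := h.oriented e he ζ hζ
    have h2 : ∀ v, coordDeriv e ψ ζ v = ofQuat (euclideanForm (fun z => toQuat (N (e.symm z)))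
        (fun z => Real.log (Kstar (e.symm z))) ζ v) := by
      intro v
      rw [← (h.structure_equation he hζ).2.2]
      simp
    rw [h2, h2, euclideanForm, vol3_gaussForm (hNd e he ζ hζ)] at h1
    rw [sphereForm, vol3_gaussForm (hNd e he ζ hζ)]
    -- Both volumes are nonnegative multiples of the same volume built from the Gauss map;
    -- positivity of the Euclidean one forces that common factor to be positive.
    refine mul_pos (by positivity) (pos_of_mul_pos_right h1 (by positivity))
  · funext p
    change stereo (leftTranslate (P p) (leftMul (P p) (N p))) = stereo (N p)
    rw [leftTranslate_leftMul (hPn p)]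

end Sphere

/-! ### The structure equation of a surface in the sphere -/

section SphereStructure

theorem leftMul_leftTranslate {q v : ℍ[ℝ]} (hq : ‖q‖ = 1) (h : inner ℝ q v = 0) :
    leftMul q (leftTranslate q v) = v := by
  rw [leftTranslate_eq, leftMul_ofQuat hq, inv_eq_star_of_norm_eq_one hq, ← mul_assoc,
    self_mul_star_of_norm_eq_one hq, one_mul, h, zero_smul, sub_zero]

/-- The structure equations of a surface in the three-sphere in terms of its Gauss map. -/
theorem structure_equation_sphere {q M : ℂ → ℍ[ℝ]} {ζ : ℂ} {κ : ℝ} (hq : DifferentiableAt ℝ q ζ)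
    (hM : DifferentiableAt ℝ M ζ) (hq1 : ∀ z, ‖q z‖ = 1) (hM1 : ∀ z, ‖M z‖ = 1)
    (htan : ∀ z, inner ℝ (M z) (q z) = 0)
    (hN : DifferentiableAt ℝ (fun z => leftTranslate (q z) (M z)) ζ)
    (hnormal : ∀ v, inner ℝ (M ζ) (fderiv ℝ q ζ v) = 0)
    (hconf : ConformalSecondForm (fderiv ℝ q ζ) (sphereCov (q ζ) (fderiv ℝ M ζ)))
    (hor : 0 < vol3 (leftTranslate (q ζ) (fderiv ℝ q ζ 1))
      (leftTranslate (q ζ) (fderiv ℝ q ζ Complex.I)) (leftTranslate (q ζ) (M ζ)))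
    (hcurv : ShapeDet (fderiv ℝ q ζ) (sphereCov (q ζ) (fderiv ℝ M ζ)) κ) :
    κ = vol3 (leftTranslate (q ζ) (fderiv ℝ M ζ 1))
        (leftTranslate (q ζ) (fderiv ℝ M ζ Complex.I)) (leftTranslate (q ζ) (M ζ)) /
      vol3 (leftTranslate (q ζ) (fderiv ℝ q ζ 1))
        (leftTranslate (q ζ) (fderiv ℝ q ζ Complex.I)) (leftTranslate (q ζ) (M ζ)) ∧
    ∀ k : ℂ → ℝ, k ζ = √κ → fderiv ℝ q ζ =
      q ζ • sphereForm (fun z => toQuat (leftTranslate (q z) (M z))) k ζ := by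
  have hL : ∀ z, leftMul (q z) (leftTranslate (q z) (M z)) = M z := fun z =>
    leftMul_leftTranslate (hq1 z) (by rw [real_inner_comm, htan])
  have hs := inv_eq_star_of_norm_eq_one (hq1 ζ)
  set N : ℂ → E3 := fun z => leftTranslate (q z) (M z) with hNdef
  have hN1 : ∀ z, ‖N z‖ = 1 := fun z => by
    rw [← sq_eq_sq₀ (norm_nonneg _) zero_le_one, ← real_inner_self_eq_norm_sq,
      ← inner_leftMul (hq1 z), hL, real_inner_self_eq_norm_sq, hM1]
  set A : ℍ[ℝ] →L[ℝ] E3 := ofQuat.comp (ContinuousLinearMap.mul ℝ ℍ[ℝ] (q ζ)⁻¹) with hA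
  have hA' : ∀ x, A x = leftTranslate (q ζ) x := fun x => rfl
  have hT : fderiv ℝ q ζ = (leftMul (q ζ)).comp (A.comp (fderiv ℝ q ζ)) :=
    ContinuousLinearMap.ext fun v =>
      (leftMul_leftTranslate (hq1 ζ) (inner_fderiv_eq_zero hq hq1 v)).symm
  have hD : sphereCov (q ζ) (fderiv ℝ M ζ) = (leftMul (q ζ)).comp (A.comp (fderiv ℝ M ζ)) := by
    refine ContinuousLinearMap.ext fun v => ?_
    change fderiv ℝ M ζ v - inner ℝ (q ζ) (fderiv ℝ M ζ v) • q ζ =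
      leftMul (q ζ) (ofQuat ((q ζ)⁻¹ * fderiv ℝ M ζ v))
    rw [leftMul_ofQuat (hq1 ζ), hs, ← mul_assoc, self_mul_star_of_norm_eq_one (hq1 ζ), one_mul]
  have hNT : ∀ v, inner ℝ (N ζ) (A (fderiv ℝ q ζ v)) = 0 := fun v => by
    rw [← inner_leftMul (hq1 ζ), hL, hA',
      leftMul_leftTranslate (hq1 ζ) (inner_fderiv_eq_zero hq hq1 v), hnormal]
  have hND : ∀ v, inner ℝ (N ζ) (A (fderiv ℝ M ζ v)) = 0 := fun v => by
    have h1 := congr_arg (fun B : ℂ →L[ℝ] ℍ[ℝ] => B v) hD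
    change fderiv ℝ M ζ v - inner ℝ (q ζ) (fderiv ℝ M ζ v) • q ζ =
      leftMul (q ζ) (A (fderiv ℝ M ζ v)) at h1
    rw [← inner_leftMul (hq1 ζ), hL, ← h1, inner_sub_right, inner_smul_right, htan,
      inner_fderiv_eq_zero hM hM1]
    simp
  rw [hT, hD] at hconf hcurv
  rw [conformalSecondForm_comp_iff _ (inner_leftMul (hq1 ζ))] at hconf
  rw [shapeDet_comp_iff _ (inner_leftMul (hq1 ζ))] at hcurv
  obtain ⟨-, hκ, hw⟩ := weingarten_of_conformal (hN1 ζ) hNT hND hconf hor hcurv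
  refine ⟨hκ, fun k hk => ?_⟩
  have hTq : ∀ v, toQuat (A (fderiv ℝ q ζ v)) = (q ζ)⁻¹ * fderiv ℝ q ζ v := fun v =>
    toQuat_ofQuat (q := (q ζ)⁻¹ * fderiv ℝ q ζ v)
      (by rw [hs, re_star_mul, inner_fderiv_eq_zero hq hq1])
  have hanti : ∀ v, ((q ζ)⁻¹ * fderiv ℝ q ζ v) * toQuat (N ζ) =
      -(toQuat (N ζ) * ((q ζ)⁻¹ * fderiv ℝ q ζ v)) := fun v => by
    rw [← hTq]
    exact anticommute_of_inner_eq_zero rfl rfl (by rw [inner_toQuat, hNT])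
  have hq0 : q ζ ≠ 0 := fun h => by simpa [h] using hq1 ζ
  -- Differentiating `M = q n` brings out the term `q⁻¹ dq n`, absent in Euclidean space; it is the
  -- source of the extra summand `n τ(v)` in the equation to be solved for `τ`.
  have hdM : ∀ v, (q ζ)⁻¹ * fderiv ℝ M ζ v =
      ((q ζ)⁻¹ * fderiv ℝ q ζ v) * toQuat (N ζ) + toQuat (fderiv ℝ N ζ v) := by
    intro v
    have h1 := hq.hasFDerivAt.mul' (toQuat.hasFDerivAt.comp ζ hN.hasFDerivAt)
    have h2 : fderiv ℝ M ζ = _ := (h1.congr_of_eventuallyEq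
      (Eventually.of_forall fun z => (hL z).symm)).fderiv
    rw [h2]
    change (q ζ)⁻¹ * (q ζ * toQuat (fderiv ℝ N ζ v) + fderiv ℝ q ζ v * toQuat (N ζ)) = _
    rw [mul_add, inv_mul_cancel_left₀ hq0, ← mul_assoc, add_comm]
  have hDq : ∀ v, toQuat (A (fderiv ℝ M ζ v)) = (q ζ)⁻¹ * fderiv ℝ M ζ v := fun v => by
    refine toQuat_ofQuat (q := (q ζ)⁻¹ * fderiv ℝ M ζ v) ?_
    rw [hdM, hanti, Quaternion.re_add, Quaternion.re_neg,
      re_mul_eq_zero_of_anticommute (hanti v)]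
    simp
  have hτ : (ContinuousLinearMap.mul ℝ ℍ[ℝ] (q ζ)⁻¹).comp (fderiv ℝ q ζ) =
      sphereForm (fun z => toQuat (N z)) k ζ := by
    refine eq_sphereForm hN hN1 fun v => ?_
    have h1 : toQuat (A (fderiv ℝ M ζ v)) =
      √κ • (toQuat (N ζ) * toQuat (A (fderiv ℝ q ζ (Complex.I * v)))) := hw v
    rw [hDq, hdM, hanti, hTq] at h1
    rw [hk]
    change toQuat (fderiv ℝ N ζ v) = toQuat (N ζ) * ((q ζ)⁻¹ * fderiv ℝ q ζ v) +
      √κ • (toQuat (N ζ) * ((q ζ)⁻¹ * fderiv ℝ q ζ (Complex.I * v)))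
    rw [← h1]
    abel
  rw [← hτ]
  refine ContinuousLinearMap.ext fun v => ?_
  change _ = q ζ * ((q ζ)⁻¹ * fderiv ℝ q ζ v)
  rw [mul_inv_cancel_left₀ hq0]

end SphereStructure

/-! ### Constructing the Euclidean curvature -/

section CurvatureForm

/-- The one-form whose integral is the logarithm of the modulus of the holomorphic part of the
extrinsic curvature; `k` is the square root of the extrinsic curvature in the sphere. -/
def curvatureForm (k : ℂ → ℝ) (z : ℂ) : ℂ →L[ℝ] ℝ :=
  (-4 / (1 + k z ^ 2)) • (fderiv ℝ k z).comp mulI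

variable {k : ℂ → ℝ} {ζ : ℂ}

theorem contDiffAt_curvatureForm (hk : ContDiffAt ℝ ∞ k ζ) :
    ContDiffAt ℝ ∞ (curvatureForm k) ζ := by
  have h : 1 + k ζ ^ 2 ≠ 0 := by positivity
  have h1 : ContDiffAt ℝ ∞ (fun z => 1 + k z ^ 2) ζ := contDiffAt_const.add (hk.pow 2)
  exact (contDiffAt_const.div h1 h).smul
    ((hk.fderiv_right (m := ∞) (by simp)).clm_comp contDiffAt_const)

/-- Since `4/(i+k) = 4k/(1+k²) - 4i/(1+k²)`, the first term together with `-2/k` integrates to the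
explicit logarithms, and `curvatureForm` is chosen so that `λ_z = -4i k_z/(1+k²)`. -/
theorem realRelation_of_primitive {lam : ℂ → ℝ} (hk : DifferentiableAt ℝ k ζ) (h0 : 0 < k ζ)
    (hl : HasFDerivAt lam (curvatureForm k ζ) ζ) :
    RealRelation k (fun z => lam z + 2 * Real.log (1 + k z ^ 2) - Real.log (k z ^ 2)) ζ := by
  have h1 : 1 + k ζ ^ 2 ≠ 0 := by positivity
  have dk := hk.hasFDerivAt
  have hg : HasDerivAt (fun x : ℝ => 2 * Real.log (1 + x ^ 2) - Real.log (x ^ 2))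
      (4 * k ζ / (1 + k ζ ^ 2) - 2 / k ζ) (k ζ) := by
    have d1 := (((hasDerivAt_pow 2 (k ζ)).const_add 1).log h1).const_mul 2
    have d2 := (hasDerivAt_pow 2 (k ζ)).log (pow_ne_zero 2 h0.ne')
    refine (d1.sub d2).congr_deriv ?_
    have := h0.ne'
    field_simp
    push_cast
    ring
  have hL : HasFDerivAt (fun z => lam z + 2 * Real.log (1 + k z ^ 2) - Real.log (k z ^ 2))
      (curvatureForm k ζ + (4 * k ζ / (1 + k ζ ^ 2) - 2 / k ζ) • fderiv ℝ k ζ) ζ := by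
    refine (hl.add (hg.comp_hasFDerivAt ζ dk)).congr_of_eventuallyEq
      (Eventually.of_forall fun z => ?_)
    simp [add_sub_assoc]
  have := h0.ne'
  rw [RealRelation, hL.fderiv]
  simp only [curvatureForm, add_apply, smul_apply, ContinuousLinearMap.comp_apply, mulI_apply,
    mul_one, Complex.I_mul_I, map_neg, smul_eq_mul]
  constructor <;> (field_simp; ring)

/-- The form is `-4 d(arctan k) ∘ i`, closed exactly when `arctan k` is harmonic; the function
differentiated in the hypothesis is `(arctan k)_z`, so the hypothesis is that harmonicity. -/
theorem closed_curvatureForm (hk : ContDiffAt ℝ ∞ k ζ) (hpos : ∀ z, 0 < k z)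
    (h : dzbar (fun w => dz (fun u => ((k u ^ 2 : ℝ) : ℂ)) w /
      (2 * (k w : ℂ) * (1 + ((k w ^ 2 : ℝ) : ℂ)))) ζ = 0) (u v : ℂ) :
    fderiv ℝ (curvatureForm k) ζ u v = fderiv ℝ (curvatureForm k) ζ v u := by
  revert u v
  rw [bilinear_symm_iff]
  have hev : ∀ᶠ z in 𝓝 ζ, DifferentiableAt ℝ k z := by
    filter_upwards [(hk.of_le (m := 1) (by simp)).eventually (by simp)] with z hz
    exact hz.differentiableAt (by simp)
  set P : ℂ → ℝ := fun z => fderiv ℝ k z 1 / (1 + k z ^ 2) with hP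
  set Q : ℂ → ℝ := fun z => fderiv ℝ k z Complex.I / (1 + k z ^ 2) with hQ
  have hk1 : ContDiffAt ℝ ∞ (fderiv ℝ k) ζ := hk.fderiv_right (m := ∞) (by simp)
  have hden : ContDiffAt ℝ ∞ (fun z => 1 + k z ^ 2) ζ := contDiffAt_const.add (hk.pow 2)
  have hden0 : ∀ z, 1 + k z ^ 2 ≠ 0 := fun z => by positivity
  have hPd : DifferentiableAt ℝ P ζ :=
    ((hk1.clm_apply contDiffAt_const).div hden (hden0 ζ)).differentiableAt (by simp)
  have hQd : DifferentiableAt ℝ Q ζ :=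
    ((hk1.clm_apply contDiffAt_const).div hden (hden0 ζ)).differentiableAt (by simp)
  have heq : (fun w => dz (fun u => ((k u ^ 2 : ℝ) : ℂ)) w /
      (2 * (k w : ℂ) * (1 + ((k w ^ 2 : ℝ) : ℂ)))) =ᶠ[𝓝 ζ]
      fun w => ((P w : ℂ) - Complex.I * (Q w : ℂ)) / 2 := by
    filter_upwards [hev] with z hz
    have h1 : (k z : ℂ) ≠ 0 := by exact_mod_cast (hpos z).ne'
    have h2 : (1 + (k z : ℂ) ^ 2) ≠ 0 := by exact_mod_cast hden0 z
    have h3 : fderiv ℝ (fun z => k z ^ 2) z = _ :=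
      ((hasDerivAt_pow 2 (k z)).comp_hasFDerivAt z hz.hasFDerivAt).fderiv
    rw [dz_ofReal (f := fun z => k z ^ 2) (hz.pow 2), h3]
    simp [hP, hQ]
    field_simp
  have hfd : HasFDerivAt (fun w => ((P w : ℂ) - Complex.I * (Q w : ℂ)) / 2) _ ζ :=
    ((hasFDerivAt_ofReal_comp hPd).sub
      ((hasFDerivAt_ofReal_comp hQd).const_mul Complex.I)).mul_const (2 : ℂ)⁻¹
  rw [dzbar, heq.fderiv_eq, hfd.fderiv] at h
  -- The real part is `P_x + Q_y = 0`, which is the vanishing of the curl.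
  have hre := congr_arg Complex.re h
  simp at hre
  have hI : (fun z => curvatureForm k z Complex.I) = fun z => 4 * P z := by
    funext z
    simp [curvatureForm, hP]
    ring
  have h1 : (fun z => curvatureForm k z 1) = fun z => -4 * Q z := by
    funext z
    simp [curvatureForm, hQ]
    ring
  have hc := (contDiffAt_curvatureForm hk).differentiableAt (by simp)
  have happ : ∀ v w, fderiv ℝ (curvatureForm k) ζ v w =
      fderiv ℝ (fun z => curvatureForm k z w) ζ v := by
    intro v w
    rw [(hc.hasFDerivAt.clm_apply (hasFDerivAt_const w ζ)).fderiv]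
    simp
  rw [happ, happ, hI, h1, (hPd.hasFDerivAt.const_mul 4).fderiv,
    (hQd.hasFDerivAt.const_mul (-4)).fderiv]
  simp
  linarith

end CurvatureForm

/-! ### From the sphere to Euclidean space -/

section Euclidean

variable {X : Type*} [TopologicalSpace X] [ChartedSpace ℂ X] [IsManifold 𝓘(ℂ) ω X]

theorem isOneForm_curvatureForm {k : X → ℝ}
    (hk : ∀ e ∈ atlas ℂ X, ∀ ζ ∈ e.target, DifferentiableAt ℝ (k ∘ e.symm) ζ) :
    IsOneForm (X := X) fun e => curvatureForm fun z => k (e.symm z) := by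
  intro e he e' he' p hp hp'
  have h1 : fderiv ℝ (fun z => k (e.symm z)) (e p) =
      (fderiv ℝ (fun z => k (e'.symm z)) (e' p)).comp (fderiv ℝ (e' ∘ e.symm) (e p)) :=
    (hasFDerivAt_change_chart he he' hp hp'
      (hk e' he' _ (e'.map_source hp')).hasFDerivAt).fderiv
  refine ContinuousLinearMap.ext fun v => ?_
  simp only [curvatureForm, smul_apply, ContinuousLinearMap.comp_apply, mulI_apply, e.left_inv hp,
    e'.left_inv hp', h1, fderiv_transition_mul_I he he' hp hp']

/-- The surface in Euclidean space with a given Gauss map and extrinsic curvature `exp L`. -/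
theorem isSurfaceR3_of_primitive {φ N : X → E3} {L : X → ℝ}
    (hN : ContMDiff 𝓘(ℝ, ℂ) 𝓘(ℝ, E3) ∞ N) (hu : ∀ p, ‖N p‖ = 1)
    (hL : ∀ e ∈ atlas ℂ X, ∀ ζ ∈ e.target, ContDiffAt ℝ ∞ (fun z => L (e.symm z)) ζ)
    (hd : ∀ e ∈ atlas ℂ X, ∀ ζ ∈ e.target, HasFDerivAt (φ ∘ e.symm)
      (ofQuat.comp (euclideanForm (fun z => toQuat (N (e.symm z))) (fun z => L (e.symm z)) ζ)) ζ)
    (hvol : ∀ e ∈ atlas ℂ X, ∀ ζ ∈ e.target,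
      0 < vol3 (ofQuat (euclideanForm (fun z => toQuat (N (e.symm z))) (fun z => L (e.symm z)) ζ 1))
        (ofQuat (euclideanForm (fun z => toQuat (N (e.symm z))) (fun z => L (e.symm z)) ζ
          Complex.I)) (N (e.symm ζ))) :
    IsSurfaceR3 φ N fun p => Real.exp (L p) := by
  have hNs : ∀ e ∈ atlas ℂ X, ∀ z ∈ e.target, ContDiffAt ℝ ∞ (fun z => N (e.symm z)) z :=
    fun e he z hz => contDiffAt_coord hN he hz
  have hNd : ∀ e ∈ atlas ℂ X, ∀ z ∈ e.target, DifferentiableAt ℝ (fun z => N (e.symm z)) z :=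
    fun e he z hz => (hNs e he z hz).differentiableAt (by simp)
  have hT : ∀ e ∈ atlas ℂ X, ∀ ζ ∈ e.target, ∀ v, coordDeriv e φ ζ v =
      ofQuat (euclideanForm (fun z => toQuat (N (e.symm z))) (fun z => L (e.symm z)) ζ v) := by
    intro e he ζ hζ v
    rw [coordDeriv, (hd e he ζ hζ).fderiv]
    rfl
  have hperp : ∀ e ∈ atlas ℂ X, ∀ ζ ∈ e.target, ∀ v,
      inner ℝ (N (e.symm ζ)) (coordDeriv e φ ζ v) = 0 := by
    intro e he ζ hζ v
    rw [hT e he ζ hζ]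
    exact inner_ofQuat_gaussForm (hNd e he ζ hζ) (fun z => hu _) v
  have hor : ∀ e ∈ atlas ℂ X, ∀ ζ ∈ e.target,
      0 < vol3 (coordDeriv e φ ζ 1) (coordDeriv e φ ζ Complex.I) (N (e.symm ζ)) := by
    intro e he ζ hζ
    rw [hT e he ζ hζ, hT e he ζ hζ]
    exact hvol e he ζ hζ
  have hcs : ∀ e ∈ atlas ℂ X, ∀ ζ ∈ e.target,
      ConformalSecondForm (coordDeriv e φ ζ) (coordDeriv e N ζ) ∧
        ShapeDet (coordDeriv e φ ζ) (coordDeriv e N ζ) (Real.exp (L (e.symm ζ))) := by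
    intro e he ζ hζ
    have h1 := conformal_of_weingarten (D := coordDeriv e N ζ) (hu (e.symm ζ)) (hperp e he ζ hζ)
      (hor e he ζ hζ) (Real.exp_pos (L (e.symm ζ) / 2)) fun v => by
        rw [hT e he ζ hζ]
        have h2 := toQuat_ofQuat_gaussForm (a := fun _ => 0)
          (b := fun z => Real.exp (-(L (e.symm z) / 2))) (hNd e he ζ hζ) (fun z => hu _)
          (Complex.I * v)
        rw [euclideanForm, h2]
        exact weingarten_euclideanForm (L := fun z => L (e.symm z)) (hNd e he ζ hζ)
          (fun z => hu _) v
    rwa [← Real.exp_nat_mul, Nat.cast_ofNat, mul_div_cancel₀ _ two_ne_zero] at h1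
  refine ⟨contMDiff_of_coord fun e he ζ hζ => ?_, hN, hu, fun e he ζ hζ =>
    injective_of_vol3_pos (hor e he ζ hζ), hperp, fun e he ζ hζ => (hcs e he ζ hζ).1, hor,
    fun e he ζ hζ => (hcs e he ζ hζ).2⟩
  refine contDiffAt_of_primitive e.open_target (fun z hz => ?_) (hd e he) hζ
  exact contDiffAt_const.clm_comp
    (contDiffAt_euclideanForm (contDiffAt_toQuat_comp (hNs e he z hz)) (hL e he z hz))

variable {ψ : X → S3} {M : X → ℍ[ℝ]} {K : X → ℝ}

omit [TopologicalSpace X] [ChartedSpace ℂ X] [IsManifold 𝓘(ℂ) ω X] in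
theorem norm_amb (ψ : X → S3) (p : X) : ‖amb ψ p‖ = 1 := mem_sphere_zero_iff_norm.1 (ψ p).2

omit [TopologicalSpace X] [ChartedSpace ℂ X] [IsManifold 𝓘(ℂ) ω X] in
theorem amb_ne_zero (ψ : X → S3) (p : X) : amb ψ p ≠ 0 :=
  norm_ne_zero_iff.1 (by rw [norm_amb]; exact one_ne_zero)

/-- The unit normal, left translated to the Lie algebra. -/
def leftNormal (ψ : X → S3) (M : X → ℍ[ℝ]) (p : X) : E3 := leftTranslate (amb ψ p) (M p)

theorem contDiffAt_leftTranslate {q v : ℂ → ℍ[ℝ]} {ζ : ℂ} (hq : ContDiffAt ℝ ∞ q ζ)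
    (hv : ContDiffAt ℝ ∞ v ζ) (h0 : q ζ ≠ 0) :
    ContDiffAt ℝ ∞ (fun z => leftTranslate (q z) (v z)) ζ := by
  have h1 := contDiffAt_ringInverse ℝ (n := ∞) (Units.mk0 (q ζ) h0)
  rw [Units.val_mk0, Ring.inverse_eq_inv'] at h1
  exact ofQuat.contDiff.contDiffAt.comp ζ (ContDiffAt.mul (h1.comp ζ hq) hv)

omit [IsManifold 𝓘(ℂ) ω X] in
theorem IsSurfaceS3.norm_leftNormal (h : IsSurfaceS3 ψ M K) (p : X) : ‖leftNormal ψ M p‖ = 1 := by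
  rw [← sq_eq_sq₀ (norm_nonneg _) zero_le_one, ← real_inner_self_eq_norm_sq,
    ← inner_leftMul (norm_amb ψ p), leftNormal, leftMul_leftTranslate (norm_amb ψ p)
      (by rw [real_inner_comm, h.tangent]), real_inner_self_eq_norm_sq, h.unit]

theorem IsSurfaceS3.contMDiff_leftNormal (h : IsSurfaceS3 ψ M K) :
    ContMDiff 𝓘(ℝ, ℂ) 𝓘(ℝ, E3) ∞ (leftNormal ψ M) :=
  contMDiff_of_coord fun _ he _ hζ => contDiffAt_leftTranslate
    (contDiffAt_coord h.smooth he hζ) (contDiffAt_coord h.smooth_normal he hζ)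
      (amb_ne_zero ψ _)

/-- The structure equation of a surface in the three-sphere in terms of its Gauss map. -/
theorem IsSurfaceS3.structure_equation (h : IsSurfaceS3 ψ M K) {e : OpenPartialHomeomorph X ℂ}
    (he : e ∈ atlas ℂ X) {ζ : ℂ} (hζ : ζ ∈ e.target) :
    ContDiffAt ℝ ∞ (fun z => K (e.symm z)) ζ ∧
      HasFDerivAt (amb ψ ∘ e.symm) (amb ψ (e.symm ζ) •
        sphereForm (fun z => toQuat (leftNormal ψ M (e.symm z))) (fun z => √(K (e.symm z))) ζ)
        ζ := by
  have hqs : ∀ z ∈ e.target, ContDiffAt ℝ ∞ (amb ψ ∘ e.symm) z :=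
    fun z hz => contDiffAt_coord h.smooth he hz
  have hMs : ∀ z ∈ e.target, ContDiffAt ℝ ∞ (M ∘ e.symm) z :=
    fun z hz => contDiffAt_coord h.smooth_normal he hz
  have hNs : ∀ z ∈ e.target, ContDiffAt ℝ ∞ (leftNormal ψ M ∘ e.symm) z :=
    fun z hz => contDiffAt_coord h.contMDiff_leftNormal he hz
  have key := fun z hz => structure_equation_sphere ((hqs z hz).differentiableAt (by simp))
    ((hMs z hz).differentiableAt (by simp)) (fun w => norm_amb ψ _) (fun w => h.unit _)
    (fun w => h.tangent _) ((hNs z hz).differentiableAt (by simp)) (h.normal e he z hz)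
    (h.conformal e he z hz) (h.oriented e he z hz) (h.curvature e he z hz)
  refine ⟨?_, ?_⟩
  · have hdM : ∀ w, ContDiffAt ℝ ∞ (fun z => leftTranslate (amb ψ (e.symm z))
        (coordDeriv e M z w)) ζ := fun w => contDiffAt_leftTranslate (hqs ζ hζ)
      (((hMs ζ hζ).fderiv_right (m := ∞) (by simp)).clm_apply contDiffAt_const) (amb_ne_zero ψ _)
    have hdq : ∀ w, ContDiffAt ℝ ∞ (fun z => leftTranslate (amb ψ (e.symm z))
        (coordDeriv e (amb ψ) z w)) ζ := fun w => contDiffAt_leftTranslate (hqs ζ hζ)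
      (((hqs ζ hζ).fderiv_right (m := ∞) (by simp)).clm_apply contDiffAt_const) (amb_ne_zero ψ _)
    refine ContDiffAt.congr_of_eventuallyEq ((contDiffAt_vol3 (hdM 1) (hdM Complex.I)
      (hNs ζ hζ)).div (contDiffAt_vol3 (hdq 1) (hdq Complex.I) (hNs ζ hζ))
        (h.oriented e he ζ hζ).ne') ?_
    filter_upwards [e.open_target.mem_nhds hζ] with z hz using (key z hz).1
  · exact ((hqs ζ hζ).differentiableAt (by simp)).hasFDerivAt.congr_fderiv
      ((key ζ hζ).2 (fun z => √(K (e.symm z))) rfl)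

/-- A surface in the sphere whose extrinsic curvature satisfies the curvature condition determines
a surface in Euclidean space with the same Gauss map. -/
theorem exists_surfaceR3 [SimplyConnectedSpace X] (h : IsSurfaceS3 ψ M K) (hpos : ∀ p, 0 < K p)
    (hcond : CurvatureCondition K) :
    ∃ (φ N : X → E3) (Kstar : X → ℝ), IsSurfaceR3 φ N Kstar ∧ (∀ p, 0 < Kstar p) ∧
      gaussMapR3 N = gaussMapS3 ψ M ∧ CurvatureRelation K Kstar := by
  set N := leftNormal ψ M with hN
  have hu : ∀ p, ‖N p‖ = 1 := h.norm_leftNormal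
  have hNs : ∀ e ∈ atlas ℂ X, ∀ z ∈ e.target, ContDiffAt ℝ ∞ (fun z => N (e.symm z)) z :=
    fun e he z hz => contDiffAt_coord h.contMDiff_leftNormal he hz
  have hNd : ∀ e ∈ atlas ℂ X, ∀ z ∈ e.target, DifferentiableAt ℝ (fun z => N (e.symm z)) z :=
    fun e he z hz => (hNs e he z hz).differentiableAt (by simp)
  have hns : ∀ e ∈ atlas ℂ X, ∀ z ∈ e.target, ContDiffAt ℝ ∞ (fun z => toQuat (N (e.symm z))) z :=
    fun e he z hz => contDiffAt_toQuat_comp (hNs e he z hz)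
  have hks : ∀ e ∈ atlas ℂ X, ∀ z ∈ e.target, ContDiffAt ℝ ∞ (fun z => √(K (e.symm z))) z :=
    fun e he z hz => (h.structure_equation he hz).1.sqrt (hpos _).ne'
  have hkpos : ∀ p, 0 < √(K p) := fun p => Real.sqrt_pos.2 (hpos p)
  obtain ⟨lam, hlam⟩ := exists_primitive
    (isOneForm_curvatureForm (k := fun p => √(K p))
      fun e he ζ hζ => (hks e he ζ hζ).differentiableAt (by simp))
    (fun e he ζ hζ => (contDiffAt_curvatureForm (hks e he ζ hζ)).of_le
      (WithTop.coe_le_coe.2 le_top))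
    (fun e he ζ hζ => closed_curvatureForm (hks e he ζ hζ) (fun z => hkpos _) (by
      simpa only [Real.sq_sqrt (hpos _).le] using hcond e he ζ hζ))
  -- Thus `K* = exp λ · (1 + K)² / K`, where `(1 + K)² = |i + √K|⁴`.
  set L : X → ℝ := fun p => lam p + 2 * Real.log (1 + √(K p) ^ 2) - Real.log (√(K p) ^ 2) with hL
  have hreal : ∀ e ∈ atlas ℂ X, ∀ ζ ∈ e.target,
      RealRelation (fun z => √(K (e.symm z))) (fun z => L (e.symm z)) ζ :=
    fun e he ζ hζ => realRelation_of_primitive ((hks e he ζ hζ).differentiableAt (by simp))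
      (hkpos _) (hlam e he ζ hζ)
  have hLs : ∀ e ∈ atlas ℂ X, ∀ ζ ∈ e.target, ContDiffAt ℝ ∞ (fun z => L (e.symm z)) ζ := by
    intro e he ζ hζ
    have h1 : ContDiffAt ℝ ∞ (fun z => lam (e.symm z)) ζ :=
      contDiffAt_of_primitive e.open_target
        (fun z hz => contDiffAt_curvatureForm (hks e he z hz)) (hlam e he) hζ
    have h2 := (hks e he ζ hζ).pow 2
    exact (h1.add (contDiffAt_const.mul ((contDiffAt_const.add h2).log (by positivity)))).sub
      (h2.log (pow_ne_zero 2 (hkpos _).ne'))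
  have hclosed : ∀ e ∈ atlas ℂ X, ∀ ζ ∈ e.target, ∀ u v,
      fderiv ℝ (euclideanForm (fun z => toQuat (N (e.symm z))) (fun z => L (e.symm z))) ζ u v =
      fderiv ℝ (euclideanForm (fun z => toQuat (N (e.symm z))) (fun z => L (e.symm z))) ζ v u := by
    intro e he ζ hζ
    refine (flat_sphereForm_iff (hns e he ζ hζ) (eventually_toQuat_mul_self fun z => hu _)
      (hks e he ζ hζ) (hLs e he ζ hζ) (hkpos _) (hreal e he ζ hζ)).1 ?_
    -- The given surface, as a quaternion valued map, is itself a nowhere zero parallel frame of the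
    -- spherical form, which is therefore flat.
    refine flat_of_parallel (F := amb ψ ∘ e.symm)
      ((contDiffAt_sphereForm (hns e he ζ hζ) (hks e he ζ hζ)).differentiableAt (by simp)) ?_
      (amb_ne_zero ψ _)
    filter_upwards [e.open_target.mem_nhds hζ] with z hz using (h.structure_equation he hz).2
  have hEs : ∀ e ∈ atlas ℂ X, ∀ ζ ∈ e.target, ContDiffAt ℝ ∞
      (euclideanForm (fun z => toQuat (N (e.symm z))) (fun z => L (e.symm z))) ζ :=
    fun e he ζ hζ => contDiffAt_euclideanForm (hns e he ζ hζ) (hLs e he ζ hζ)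
  obtain ⟨φ, hφ⟩ := exists_primitive_E3
    (θ := fun e z => ofQuat.comp
      (euclideanForm (fun z => toQuat (N (e.symm z))) (fun z => L (e.symm z)) z))
    ((isOneForm_gaussForm (n := fun p => toQuat (N p))
      (fun e he ζ hζ => (hns e he ζ hζ).differentiableAt (by simp))
      (fun _ => 0) (fun p => Real.exp (-(L p / 2)))).comp ofQuat)
    (fun e he ζ hζ => contDiffAt_const.clm_comp (hEs e he ζ hζ))
    (fun e he ζ hζ u v => by
      have h1 := ((ContinuousLinearMap.compL ℝ ℂ ℍ[ℝ] E3 ofQuat).hasFDerivAt.comp ζ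
        ((hEs e he ζ hζ).differentiableAt (by simp)).hasFDerivAt).fderiv
      have h2 := congr_arg ofQuat (hclosed e he ζ hζ u v)
      refine (DFunLike.congr_fun (DFunLike.congr_fun h1 u) v).trans (h2.trans ?_)
      exact (DFunLike.congr_fun (DFunLike.congr_fun h1 v) u).symm)
  refine ⟨φ, N, fun p => Real.exp (L p),
    isSurfaceR3_of_primitive h.contMDiff_leftNormal hu hLs hφ ?_, fun p => Real.exp_pos _, rfl, ?_⟩
  · intro e he ζ hζ
    have h1 := h.oriented e he ζ hζ
    have h2 : ∀ v, leftTranslate (amb ψ (e.symm ζ)) (coordDeriv e (amb ψ) ζ v) =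
        ofQuat (sphereForm (fun z => toQuat (N (e.symm z))) (fun z => √(K (e.symm z))) ζ v) := by
      intro v
      rw [leftTranslate_eq, coordDeriv, (h.structure_equation he hζ).2.fderiv]
      change ofQuat ((amb ψ (e.symm ζ))⁻¹ * (amb ψ (e.symm ζ) * _)) = _
      rw [inv_mul_cancel_left₀ (amb_ne_zero ψ _)]
      rfl
    change 0 < vol3 _ _ (N (e.symm ζ)) at h1
    rw [h2, h2, sphereForm, vol3_gaussForm (hNd e he ζ hζ)] at h1
    rw [euclideanForm, vol3_gaussForm (hNd e he ζ hζ)]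
    refine mul_pos (by positivity) (pos_of_mul_pos_right h1 (by positivity))
  · intro e he ζ hζ
    have h1 := (realRelation_iff ((hks e he ζ hζ).differentiableAt (by simp))
      ((hLs e he ζ hζ).differentiableAt (by simp)) (hkpos _)).2 (hreal e he ζ hζ)
    simp only [curvatureFactor_eq hpos, Real.log_exp]
    exact h1

end Euclidean

end GaussMapSurfaces

end

/-! ### The correspondence -/

theorem proposition3p10 {X : Type*} [TopologicalSpace X] [T2Space X] [SimplyConnectedSpace X]
    [ChartedSpace ℂ X] [IsManifold 𝓘(ℂ) ω X] :
    (∀ (ψ : X → GaussMapSurfaces.S3) (N : X → ℍ[ℝ]) (K : X → ℝ),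
      GaussMapSurfaces.IsSurfaceS3 ψ N K → (∀ p, 0 < K p) →
      GaussMapSurfaces.CurvatureCondition K →
      ∃ (ψstar Nstar : X → GaussMapSurfaces.E3) (Kstar : X → ℝ),
        GaussMapSurfaces.IsSurfaceR3 ψstar Nstar Kstar ∧ (∀ p, 0 < Kstar p) ∧
        GaussMapSurfaces.gaussMapR3 Nstar = GaussMapSurfaces.gaussMapS3 ψ N ∧
        GaussMapSurfaces.CurvatureRelation K Kstar) ∧
    (∀ (ψstar Nstar : X → GaussMapSurfaces.E3) (Kstar : X → ℝ),
      GaussMapSurfaces.IsSurfaceR3 ψstar Nstar Kstar → (∀ p, 0 < Kstar p) →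
      ∀ K : X → ℝ, ContMDiff 𝓘(ℝ, ℂ) 𝓘(ℝ, ℝ) ∞ K → (∀ p, 0 < K p) →
      GaussMapSurfaces.CurvatureRelation K Kstar →
      ∃ (ψ : X → GaussMapSurfaces.S3) (N : X → ℍ[ℝ]),
        GaussMapSurfaces.IsSurfaceS3 ψ N K ∧
        GaussMapSurfaces.gaussMapS3 ψ N = GaussMapSurfaces.gaussMapR3 Nstar) :=
  ⟨fun _ _ _ h hpos hcond => GaussMapSurfaces.exists_surfaceR3 h hpos hcond,
    fun _ _ _ h _ _ hK hpos hrel => GaussMapSurfaces.exists_surfaceS3 h hK hpos hrel⟩
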